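/- **Setting.** Let $L$ be the line $\mathcal Z=0$ in the complex projective plane $\mathbb P^2$ and $p=(1:0:0)$. Let $C$ be an integral plane curve of degree $d$, with equation $F(\mathcal X,\mathcal Y,\mathcal Z)=0$, having one place at infinity at $p$: $C\cap L=\{p\}$ and $C$ is reduced and unibranch at $p$. Let $\mathcal P_C$ be the pencil of the curves $\lambda F+\mu\mathcal Z^d=0$. Let $p_1=p$ and, for $i\ge 1$, let $p_{i+1}$ be the point of the exceptional divisor $E_{p_i}$ lying on the strict transform of $C$; let $n$ be the least integer such that blowing up $p_1,\dots,p_n$ eliminates the base points of $\mathcal P_C$. Write $s_0=n$ and $p_{0\,\ell}=p_\ell$ for $1\le \ell\le n$. Let $k\ge 0$. For $1\le j\le k$ let $s_j\ge 1$, let $p_{j\,1}$ be a free point of $E_{p_n}$ (the points $p_{1\,1},\dots,p_{k\,1}$ being pairwise different), and let $p_{j\,1},\dots,p_{j\,s_j}$ be free points, each $p_{j\,\ell+1}$ lying on the exceptional divisor $E_{p_{j\,\ell}}$, through all of which passes the strict transform of a curve $C_j$ of $\mathcal P_C$ with support different from $L$. Let $\mathcal C$ be the configuration of all the points $p_{j\,\ell}$,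 $0\le j\le k$, $1\le \ell\le s_j$, and let $\widetilde X$ be the surface obtained from $\mathbb P^2$ by blowing up $\mathcal C$. Thus $\mathrm{NS}_{\mathbb R}(\widetilde X)$ has the basis formed by the class $E^*_{0\,0}$ of the total transform of a line and the classes $E_{j\,\ell}^*$ of the total transforms of the exceptional divisors; this basis is orthogonal for the intersection product, with $(E^*_{0\,0})^2=1$ and $(E_{j\,\ell}^*)^2=-1$. For $q\in\mathcal C$ let $\varphi_q$ be an analytically irreducible germ at $p$ whose strict transform on the surface obtained by blowing up $q$ is transversal to $E_q$ at a general point of $E_q$ (it suffices: at a point of $E_q$ that lies neither on another exceptional divisor nor on the strict transform of $L$). Let $\varphi_L$ be the germ of $L$ at $p$, let $(\cdot,\cdot)_p$ be the intersection multiplicity at $p$, let $\operatorname{mult}_{q'}(\varphi_q)$ be the multiplicity at $q'$ of the strict transform of $\varphi_q$, and set $$D_q:=(\varphi_L,\varphi_q)_p\,E_{0\,0}^*-\sum_{q'}\operatorname{mult}_{q'}(\varphi_q)\,E_{q'}^*,$$ where $q'$ runs over the points of $\mathcal C$ to which $q$ is infinitely near (including $q'=q$). Put $D_{0\,0}:=E_{0\,0}^*$,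 and $D_{j\,m}:=D_{p_{j\,m}}$ for $0\le j\le k$ and $1\le m\le s_j$. For $0\le m\le s_0$ let $a_m:=D_{0\,m}\cdot D_{0\,s_0}$. For a nonempty subset $J\subseteq\{1,\dots,k\}$, a tuple $\bar\ell_J=(\ell_j)_{j\in J}$ with $1\le\ell_j\le s_j$, and $0\le m\le s_0-1$, let $\Pi:=\prod_{j\in J}\ell_j$ and $$D_{0\,m}^{J,\bar\ell_J}:=a_m\sum_{j\in J}\frac{\Pi}{\ell_j}\,D_{j\,\ell_j}+\Pi\, D_{0\,m}.$$ **Proposition 3.3.** All these divisor classes have nonnegative self-intersection: 1. $D_{0\,m}^2\ge 0$ for every $0\le m\le s_0$; 2. $\bigl(D_{0\,m}^{J,\bar\ell_J}\bigr)^2\ge 0$ for every nonempty $J\subseteq\{1,\dots,k\}$, every $\bar\ell_J$ as above and every $0\le m\le s_0-1$. -/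

import Mathlib

namespace PencilAtInfinity

/-! ### Germs, blowing up and infinitely near points

Homogeneous coordinates `(𝒳 : 𝒴 : 𝒵)` of the complex projective plane are the variables `0, 1, 2`
of `MvPolynomial (Fin 3) ℂ`.  The line at infinity `L` is `𝒵 = 0` and `p = (1 : 0 : 0)`. -/

/-- (Formal) functions at a smooth point of a surface, in local coordinates `(u, v) = (X 0, X 1)`.
A curve germ is given by an equation. -/
abbrev Germ : Type := MvPowerSeries (Fin 2) ℂ

/-- A point infinitely near to `p`, or `p` itself, given by the successive directions in which one
has to move when blowing up.  The empty list is `p`.  If `q` is a point with local coordinates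
`(u, v)`, then the points of the exceptional divisor `E_q` of the blowup at `q` are the
points `q ++ [t]` with `t ∈ ℙ¹ = ℂ ∪ {∞}` (the tangent directions at `q`). -/
abbrev InfPoint : Type := List (OnePoint ℂ)

/-- The blowup of `(u, v)` in local coordinates `(u', v')` at a point of the exceptional divisor.
At the direction `t ∈ ℂ` it is `(u, v) = (u', u' (v' + t))`, at the direction `∞` (the tangent
`u = 0`) it is `(u, v) = (u' v', u')`.  In all cases `u' = 0` is the exceptional divisor. -/
noncomputable def chart : OnePoint ℂ → Fin 2 → Germ
  | OnePoint.some t => ![MvPowerSeries.X 0,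
      MvPowerSeries.X 0 * (MvPowerSeries.X 1 + MvPowerSeries.C t)]
  | OnePoint.infty => ![MvPowerSeries.X 0 * MvPowerSeries.X 1, MvPowerSeries.X 0]

theorem chart_coe (t : ℂ) : chart (t : OnePoint ℂ) = ![MvPowerSeries.X 0,
    MvPowerSeries.X 0 * (MvPowerSeries.X 1 + MvPowerSeries.C t)] := rfl

theorem chart_infty : chart OnePoint.infty =
    ![MvPowerSeries.X 0 * MvPowerSeries.X 1, MvPowerSeries.X 0] := rfl

theorem hasSubst_chart (t : OnePoint ℂ) : MvPowerSeries.HasSubst (chart t) := by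
  apply MvPowerSeries.hasSubst_of_constantCoeff_zero
  intro i
  rcases t with _ | t <;> fin_cases i <;> simp [chart]

/-- Pull-back (total transform) of a function under the blowup, at the direction `t`. -/
noncomputable def totalTransform (t : OnePoint ℂ) (f : Germ) : Germ :=
  MvPowerSeries.subst (chart t) f

/-- The quotient of `h` by `u ^ m`; it is used for `h` divisible by `u ^ m`. -/
noncomputable def divExceptional (m : ℕ) (h : Germ) : Germ :=
  fun e => MvPowerSeries.coeff (e + Finsupp.single 0 m) h

/-- Strict transform under one blowup, at the point of direction `t`: the total transform divided
by the `μ`-th power of the equation of the exceptional divisor, `μ` being the multiplicity. -/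
noncomputable def strictTransform₁ (f : Germ) (t : OnePoint ℂ) : Germ :=
  divExceptional f.order.toNat (totalTransform t f)

/-- The division in the definition of the strict transform is exact. -/
theorem X_pow_mul_strictTransform₁ (f : Germ) (t : OnePoint ℂ) :
    MvPowerSeries.X 0 ^ f.order.toNat * strictTransform₁ f t = totalTransform t f := by
  have key : MvPowerSeries.X 0 ^ f.order.toNat ∣ totalTransform t f := by
    rw [MvPowerSeries.X_pow_dvd_iff]
    intro e he
    rw [totalTransform, MvPowerSeries.coeff_subst (hasSubst_chart t)]
    refine finsum_eq_zero_of_forall_eq_zero fun d => ?_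
    by_cases hd : (d.degree : ℕ∞) < f.order
    · rw [MvPowerSeries.coeff_of_lt_order hd, zero_smul]
    · have hle : f.order.toNat ≤ d.degree := by
        have := ENat.toNat_le_toNat (not_lt.mp hd) (ENat.natCast_ne_top _)
        simpa using this
      have hdeg : d.degree = d 0 + d 1 := by
        simp [Finsupp.degree_eq_sum]
      have hX : (MvPowerSeries.X 0 : Germ) ^ (d 0 + d 1) ∣ d.prod fun s n => chart t s ^ n := by
        rw [Finsupp.prod_fintype _ _ (by simp), Fin.prod_univ_two, pow_add]
        refine mul_dvd_mul (pow_dvd_pow_of_dvd ?_ _) (pow_dvd_pow_of_dvd ?_ _) <;>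
          rcases t with _ | t <;> simp [chart]
      rw [MvPowerSeries.X_pow_dvd_iff.mp hX e (by omega), smul_zero]
  obtain ⟨g, hg⟩ := key
  rw [strictTransform₁, hg]
  congr 1
  ext e
  have h1 : MvPowerSeries.coeff e (divExceptional f.order.toNat
      (MvPowerSeries.X 0 ^ f.order.toNat * g)) = MvPowerSeries.coeff
      (e + Finsupp.single 0 f.order.toNat) (MvPowerSeries.X 0 ^ f.order.toNat * g) := rfl
  rw [h1, MvPowerSeries.X_pow_eq, add_comm, MvPowerSeries.coeff_add_monomial_mul, one_mul]

/-- Strict transform of a germ after blowing up along a list of directions. -/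
noncomputable def strictTransform (f : Germ) (q : InfPoint) : Germ :=
  q.foldl strictTransform₁ f

/-- The strict transform of the germ `f` passes through `q`. -/
def PassesThrough (f : Germ) (q : InfPoint) : Prop :=
  MvPowerSeries.constantCoeff (strictTransform f q) = 0

/-- `mult_q(f)`: multiplicity at `q` of the strict transform of the germ `f`. -/
noncomputable def mult (q : InfPoint) (f : Germ) : ℕ :=
  (strictTransform f q).order.toNat

/-- Intersection multiplicity `(f, g)_p = dim_ℂ ℂ⟦u, v⟧ / (f, g)`. -/
noncomputable def interMult (f g : Germ) : ℕ :=
  Module.finrank ℂ (Germ ⧸ Ideal.span {f, g})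

/-- `q'` is proximate to `q`: it lies over `q`, on the exceptional divisor `E_q` or on its strict
transform.  At the point `q ++ [t]` the equation of `E_q` is `u = 0`. -/
def IsProximate (q' q : InfPoint) : Prop :=
  ∃ (t : OnePoint ℂ) (r : InfPoint), q' = q ++ t :: r ∧ PassesThrough (MvPowerSeries.X 0) r

/-- A point is satellite if it is proximate to two different points, and free otherwise. -/
def IsFree (q : InfPoint) : Prop :=
  ¬ ∃ q₁ q₂ : InfPoint, q₁ ≠ q₂ ∧ IsProximate q q₁ ∧ IsProximate q q₂

/-- The germ at `p` of the plane curve of equation `G = 0`, in the local coordinates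
`(u, v) = (𝒴 / 𝒳, 𝒵 / 𝒳)`. -/
noncomputable def germAtP (G : MvPolynomial (Fin 3) ℂ) : Germ :=
  MvPolynomial.aeval ![1, MvPowerSeries.X 0, MvPowerSeries.X 1] G

/-- `φ_L`, the germ at `p` of the line at infinity. -/
noncomputable def germL : Germ := germAtP (MvPolynomial.X 2)

/-- `φ` can be taken as the germ `φ_q`: it is an analytically irreducible germ at `p` whose strict
transform on the surface obtained by blowing up `q` is transversal to `E_q` (of equation `u = 0`)
at a general point, that is, at a point that lies neither on another exceptional divisor nor on
the strict transform of `L`. -/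
def IsCurvette (q : InfPoint) (φ : Germ) : Prop :=
  Irreducible φ ∧ ∃ t : OnePoint ℂ,
    IsFree (q ++ [t]) ∧ ¬ PassesThrough germL (q ++ [t]) ∧
    PassesThrough φ (q ++ [t]) ∧
    MvPowerSeries.coeff (Finsupp.single 1 1) (strictTransform φ (q ++ [t])) ≠ 0

/-! ### Pencils at infinity and their base points -/

/-- Weak (virtual) transform of a pencil spanned by two functions: the fixed exceptional part of
the total transform of the pencil is removed. -/
noncomputable def pencilTransform₁ (fg : Germ × Germ) (t : OnePoint ℂ) : Germ × Germ :=
  let m := (min fg.1.order fg.2.order).toNat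
  (divExceptional m (totalTransform t fg.1), divExceptional m (totalTransform t fg.2))

/-- The point `q` is a base point (proper or infinitely near) of the pencil spanned by `f`
and `g`: all members of the transformed pencil pass through it. -/
def IsBasePoint (f g : Germ) (q : InfPoint) : Prop :=
  MvPowerSeries.constantCoeff (q.foldl pencilTransform₁ (f, g)).1 = 0 ∧
  MvPowerSeries.constantCoeff (q.foldl pencilTransform₁ (f, g)).2 = 0

/-- An integral projective plane curve `C : F = 0` of degree `d` with one place at infinity: it
meets the line at infinity `𝒵 = 0` only at `p = (1 : 0 : 0)`, where it is reduced and unibranch. -/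
structure CurveOnePlace where
  d : ℕ
  F : MvPolynomial (Fin 3) ℂ
  homogeneous : F.IsHomogeneous d
  irreducible : Irreducible F
  inter_L : ∀ x y : ℂ, (x ≠ 0 ∨ y ≠ 0) → (MvPolynomial.eval ![x, y, 0] F = 0 ↔ y = 0)
  unibranch : Irreducible (germAtP F)

/-- The member `a F + b 𝒵 ^ d` of the pencil at infinity defined by `C`. -/
noncomputable def CurveOnePlace.member (C : CurveOnePlace) (a b : ℂ) : MvPolynomial (Fin 3) ℂ :=
  MvPolynomial.C a * C.F + MvPolynomial.C b * MvPolynomial.X 2 ^ C.d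

/-- A base point of the pencil at infinity defined by `C`. -/
def CurveOnePlace.IsBasePoint (C : CurveOnePlace) (q : InfPoint) : Prop :=
  PencilAtInfinity.IsBasePoint (germAtP C.F) (germAtP (MvPolynomial.X 2 ^ C.d)) q

/-- The configuration `ℬ = {p_i}_{i=1}^n`: `p₁ = p`, each `p_{i+1}` is the point of `E_{p_i}` on
the strict transform of `C`, and `n` is the least number such that blowing up `p₁, …, p_n`
eliminates the base points of the pencil. -/
structure BaseConfiguration (C : CurveOnePlace) where
  p : ℕ → InfPoint
  p_one : p 1 = []
  p_succ : ∀ i, 1 ≤ i → ∃ t, p (i + 1) = p i ++ [t]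
  p_mem : ∀ i, 1 ≤ i → PassesThrough (germAtP C.F) (p i)
  n : ℕ
  n_least : IsLeast {N : ℕ | ∀ q, C.IsBasePoint q → ∃ i, 1 ≤ i ∧ i ≤ N ∧ q = p i} n

/-- The configuration `𝒞 = ℬ ∪ 𝒟`, where `𝒟` consists of the points `p_{j ℓ}`, `1 ≤ ℓ ≤ s j`, for
`j` in an index set with `k` elements.  Here `p_{j 1}` is a free point of `E_{p_n}` (different `j`
give different points), and `p_{j 1}, …, p_{j (s j)}` are successive free points on the strict
transform of a curve `C_j` of the pencil with support different from `L`. -/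
structure ExtendedConfiguration (C : CurveOnePlace) extends BaseConfiguration C where
  k : ℕ
  s : Fin k → ℕ
  s_pos : ∀ j, 1 ≤ s j
  pt : Fin k → ℕ → InfPoint
  pt_one : ∀ j, ∃ t, pt j 1 = p n ++ [t]
  pt_one_injective : Function.Injective fun j => pt j 1
  pt_succ : ∀ j i, 1 ≤ i → i < s j → ∃ t, pt j (i + 1) = pt j i ++ [t]
  pt_free : ∀ j i, 1 ≤ i → i ≤ s j → IsFree (pt j i)
  pt_mem : ∀ j, ∃ a b : ℂ, a ≠ 0 ∧
    ∀ i, 1 ≤ i → i ≤ s j → PassesThrough (germAtP (C.member a b)) (pt j i)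

namespace ExtendedConfiguration

variable {C : CurveOnePlace} (S : ExtendedConfiguration C)

open Classical in
/-- The finite set of points of `𝒞`. -/
noncomputable def points : Finset InfPoint :=
  (Finset.Icc 1 S.n).image S.p ∪
    Finset.univ.biUnion fun j => (Finset.Icc 1 (S.s j)).image (S.pt j)

/-! ### The Néron–Severi space of the surface obtained by blowing up `𝒞` -/

/-- `NS_ℝ` of the surface obtained from the plane by blowing up the points of `𝒞`: the real vector
space with basis the class `E₀₀*` of the total transform of a line (index `none`) and the
classes `E_q*` of the total transforms of the exceptional divisors, `q ∈ 𝒞`. -/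
abbrev NS : Type := Option {q : InfPoint // q ∈ S.points} → ℝ

open Classical in
/-- `E₀₀*`, the total transform of a general line. -/
noncomputable def lineClass : S.NS := Pi.single none 1

open Classical in
/-- `E_q*`, the total transform of the exceptional divisor of the blowup at `q`. -/
noncomputable def excClass (q : {q : InfPoint // q ∈ S.points}) : S.NS := Pi.single (some q) 1

/-- The intersection product: `(E₀₀*)² = 1`, `(E_q*)² = -1`, and different basis elements are
orthogonal. -/
noncomputable def inter (D D' : S.NS) : ℝ :=
  D none * D' none - ∑ q : {q : InfPoint // q ∈ S.points}, D (some q) * D' (some q)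

/-! ### The two families of divisors

Here `φ` assigns to each point `q` of `𝒞` a germ `φ_q`. -/

variable (φ : InfPoint → Germ)

open Classical in
/-- For a point `q` of `𝒞`, the class
`(φ_L, φ_q)_p E₀₀* - ∑ mult_{q'}(φ_q) E_{q'}*`, the sum over the points `q'` of `𝒞` such that `q`
is infinitely near or equal to `q'`. -/
noncomputable def divisor (q : InfPoint) : S.NS :=
  (interMult germL (φ q) : ℝ) • S.lineClass -
    ∑ q' : {q' : InfPoint // q' ∈ S.points} with q'.1 <+: q,
      (mult q'.1 (φ q) : ℝ) • S.excClass q'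

/-- `D_{0 m}`, `0 ≤ m ≤ n`: `D_{0 0} = E₀₀*`, and `D_{0 m}` is the class of the point `p_m`
for `m ≥ 1`. -/
noncomputable def D₀ : ℕ → S.NS
  | 0 => S.lineClass
  | m + 1 => S.divisor φ (S.p (m + 1))

/-- `D_{j m}`, `1 ≤ m ≤ s j`. -/
noncomputable def D (j : Fin S.k) (m : ℕ) : S.NS := S.divisor φ (S.pt j m)

/-- `a_m = D_{0 m} · D_{0 n}`. -/
noncomputable def a (m : ℕ) : ℝ := S.inter (S.D₀ φ m) (S.D₀ φ S.n)

/-- `D_{0 m}^{J, ℓ} = a_m ∑_{j ∈ J} (Π / ℓ_j) D_{j ℓ_j} + Π D_{0 m}`, with `Π = ∏_{j ∈ J} ℓ_j`. -/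
noncomputable def DJ (J : Finset (Fin S.k)) (ℓ : Fin S.k → ℕ) (m : ℕ) : S.NS :=
  S.a φ m • ∑ j ∈ J, ((∏ i ∈ J, (ℓ i : ℝ)) / (ℓ j : ℝ)) • S.D φ j (ℓ j) +
    (∏ i ∈ J, (ℓ i : ℝ)) • S.D₀ φ m

end ExtendedConfiguration

end PencilAtInfinity

/-!
The self-intersections are computed by a quadratic form attached to the sequence of blowups. At an
infinitely near point `q ≠ p` take local coordinates in which `u = 0` is the last exceptional
divisor, and `v = 0` is the other special curve through `q`, if there is one: the strict transform
of `L` or of an earlier exceptional divisor. For an irreducible germ `f` with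
`x = (f, u = 0)_q` and `y = (f, v = 0)_q`, Noether's formula takes the shape
`(φ_L, f)_p ^ 2 - ∑ mult_{q'}(f) ^ 2 = a x ^ 2 + b x y + c y ^ 2`, the sum over the points before
`q`, where `a, b, c` depend on `q` only and obey a simple recursion (`PathForm.step`,
`axisOrder_sq_eq`). A curvette of `q` leaves `E_q` at a general point, with `x = 1` and no curve
`v = 0`, so that `D_q ^ 2` is the coefficient `a` of a general point of `E_q`.

The recursion preserves nonnegativity of the coefficients unless it comes to a general point of an
exceptional divisor with `a = 0`. Let `q` be on the path of the curve `C`. As long as there are base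
points, the fixed part of the pencil is that of `C`, and the transform of the member `d L` is a unit
times `u ^ α v ^ β`, with `α x + β y = a x ^ 2 + b x y + c y ^ 2` for the germ `f` of `C`
(`exists_pencil_eq`: both sides are the intersection number of two members left over after the
blowups). If there is no curve `v = 0` and `a = 0`, this gives `α = 0`, and `q` is not a base point.
So the forms of `p_1, …, p_n` are positive, which gives `D_{0 m} ^ 2 ≥ 0`. Conversely, a
positive form excludes `α = β = 0`. So at `p_{n + 1}`, the first point on `C` that is not a base
point, the form vanishes, which gives `D_{0 n} ^ 2 = 0`.

A curvette of `p_{j ℓ}` passes through free points off `L` after `p_n`. Hence it is smooth from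
`p_n` on and has the multiplicities of a curvette of `p_n` before
(`IsCurvette.mult_eq_of_free_chain`), so that `D_{j ℓ} = D_{0 n} + W_j` with
`W_j = -(E_{j 1}^* + ⋯ + E_{j ℓ}^*)`. The `W_j` are orthogonal to each other and to all `D_{0 m}`,
and `W_j ^ 2 ≥ -ℓ_j`. With `σ = ∑ Π / ℓ_j` the square of `D_{0 m}^{J, ℓ}` is then at least
`-a_m ^ 2 Π σ + 2 a_m ^ 2 Π σ + Π ^ 2 D_{0 m} ^ 2 ≥ 0` (`bilinForm_self_nonneg`).

The local input is that the strict transform of an irreducible germ is irreducible or a unit, and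
that the germ has a single tangent. Both come from Weierstrass preparation: a Weierstrass factor of
the strict transform blows down to a Weierstrass factor of the germ
(`exists_weierstrass_of_dvd_strictTransform₁`).
-/

namespace PencilAtInfinity

/-! ### Restriction to the coordinate axes -/

/-- Restriction of a function to the `i`-th coordinate axis. -/
noncomputable def restr (i : Fin 2) : Germ →ₐ[ℂ] PowerSeries ℂ :=
  MvPowerSeries.killCompl (Function.Embedding.punit i)

theorem coeff_restr (i : Fin 2) (f : Germ) (n : ℕ) :
    PowerSeries.coeff n (restr i f) = MvPowerSeries.coeff (Finsupp.single i n) f := by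
  have h := MvPowerSeries.coeff_killCompl (e := Function.Embedding.punit i) f (Finsupp.single () n)
  rwa [Finsupp.embDomain_single] at h

theorem restr_X_self (i : Fin 2) : restr i (MvPowerSeries.X i) = PowerSeries.X :=
  MvPowerSeries.killCompl_X (e := Function.Embedding.punit i) ()

theorem restr_X_of_ne {i j : Fin 2} (h : j ≠ i) : restr i (MvPowerSeries.X j) = 0 :=
  MvPowerSeries.killCompl_X_eq_zero (by rintro ⟨x, hx⟩; exact h hx.symm)

theorem restr_C (i : Fin 2) (c : ℂ) : restr i (MvPowerSeries.C c) = PowerSeries.C c :=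
  MvPowerSeries.killCompl_C c

theorem constantCoeff_restr (i : Fin 2) (f : Germ) :
    PowerSeries.constantCoeff (restr i f) = MvPowerSeries.constantCoeff f := by
  rw [← PowerSeries.coeff_zero_eq_constantCoeff_apply, coeff_restr]
  simp

/-- The intersection multiplicity of `f` with `u = 0` for `i = 1`, and with `v = 0` for `i = 0`:
the order of the restriction of `f` to the `i`-th coordinate axis. -/
noncomputable def axisOrder (i : Fin 2) (f : Germ) : ℕ∞ := (restr i f).order

theorem axisOrder_mul (i : Fin 2) (f g : Germ) :
    axisOrder i (f * g) = axisOrder i f + axisOrder i g := by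
  simp [axisOrder, PowerSeries.order_mul]

theorem isUnit_iff_constantCoeff_ne_zero (f : Germ) :
    IsUnit f ↔ MvPowerSeries.constantCoeff f ≠ 0 := by
  rw [MvPowerSeries.isUnit_iff_constantCoeff, isUnit_iff_ne_zero]

theorem axisOrder_eq_zero_iff (i : Fin 2) (f : Germ) : axisOrder i f = 0 ↔ IsUnit f := by
  rw [axisOrder, isUnit_iff_constantCoeff_ne_zero, ← constantCoeff_restr i, ← not_iff_not, not_not]
  exact PowerSeries.order_ne_zero_iff_constCoeff_eq_zero

theorem order_le_axisOrder (i : Fin 2) (f : Germ) : f.order ≤ axisOrder i f := by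
  refine PowerSeries.le_order _ _ fun n hn => ?_
  rw [coeff_restr]
  exact MvPowerSeries.coeff_of_lt_order (by simpa using hn)

theorem coe_toNat_order {f : Germ} (hf : f ≠ 0) : (f.order.toNat : ℕ∞) = f.order :=
  MvPowerSeries.ne_zero_iff_order_finite.mp hf

theorem order_eq_zero_of_isUnit {f : Germ} (hf : IsUnit f) : f.order = 0 := by
  have := order_le_axisOrder 0 f
  rw [(axisOrder_eq_zero_iff 0 f).mpr hf] at this
  simpa using this

theorem axisOrder_eq_top_iff (i j : Fin 2) (hij : j ≠ i) (f : Germ) :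
    axisOrder i f = ⊤ ↔ MvPowerSeries.X j ∣ f := by
  rw [axisOrder, PowerSeries.order_eq_top]
  constructor
  · intro h
    rw [MvPowerSeries.X_dvd_iff]
    intro m hm
    have : m = Finsupp.single i (m i) := by
      ext k
      have : k = i ∨ k = j := by omega
      rcases this with rfl | rfl <;> simp [hm, hij]
    rw [this, ← coeff_restr, h, map_zero]
  · rintro ⟨g, rfl⟩
    rw [map_mul, restr_X_of_ne hij, zero_mul]

/-! ### Germs as power series over a power series ring -/

/-- The two coordinates, `v` being singled out. -/
def coordEquiv : Fin 2 ≃ Option Unit where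
  toFun i := if i = 0 then some () else none
  invFun o := if o = none then 1 else 0
  left_inv i := by fin_cases i <;> simp
  right_inv o := by rcases o with _ | ⟨⟩ <;> simp

/-- The identification `ℂ⟦u, v⟧ = ℂ⟦u⟧⟦v⟧`. -/
noncomputable def iterEquiv : Germ ≃ₐ[ℂ] PowerSeries (PowerSeries ℂ) :=
  (MvPowerSeries.renameEquiv ℂ coordEquiv).trans (MvPowerSeries.optionEquivLeft Unit ℂ)

theorem iterEquiv_X_one : iterEquiv (MvPowerSeries.X 1) = PowerSeries.X := by
  have : MvPowerSeries.renameEquiv ℂ coordEquiv (MvPowerSeries.X 1) = MvPowerSeries.X none :=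
    MvPowerSeries.rename_X _ 1
  rw [iterEquiv, AlgEquiv.trans_apply, this]
  exact MvPowerSeries.optionEquivLeft_X_none

theorem coeff_coeff_iterEquiv (f : Germ) (i j : ℕ) :
    PowerSeries.coeff i (PowerSeries.coeff j (iterEquiv f)) =
      MvPowerSeries.coeff (Finsupp.single 0 i + Finsupp.single 1 j) f := by
  rw [iterEquiv, AlgEquiv.trans_apply]
  rw [PowerSeries.coeff]
  erw [MvPowerSeries.coeff_coeff_optionEquivLeft]
  have h : (Finsupp.single () i).optionElim j =
      (Finsupp.single 0 i + Finsupp.single 1 j : Fin 2 →₀ ℕ).embDomain coordEquiv.toEmbedding := by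
    ext o
    rcases o with _ | ⟨⟩
    · have : (none : Option Unit) = coordEquiv.toEmbedding 1 := by simp [coordEquiv]
      rw [this, Finsupp.embDomain_apply_self, ← this]
      simp
    · have : (some () : Option Unit) = coordEquiv.toEmbedding 0 := by simp [coordEquiv]
      rw [this, Finsupp.embDomain_apply_self, ← this]
      simp
  rw [h]
  exact MvPowerSeries.coeff_embDomain_rename coordEquiv.toEmbedding f _

theorem iterEquiv_toMvPowerSeries (a : PowerSeries ℂ) :
    iterEquiv (a.toMvPowerSeries 0) = PowerSeries.C a := by
  ext j i
  rw [coeff_coeff_iterEquiv, PowerSeries.toMvPowerSeries_apply]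
  rcases Nat.eq_zero_or_pos j with rfl | hj
  · have h := MvPowerSeries.coeff_embDomain_rename (Function.Embedding.punit (0 : Fin 2)) a
      (Finsupp.single () i)
    rw [Finsupp.embDomain_single] at h
    rw [Finsupp.single_zero, add_zero, PowerSeries.coeff_zero_eq_constantCoeff_apply,
      PowerSeries.constantCoeff_C]
    exact h
  · rw [PowerSeries.coeff_C, if_neg hj.ne', map_zero]
    refine MvPowerSeries.coeff_rename_eq_zero (f := fun _ : Unit => (0 : Fin 2)) a ?_
    rintro ⟨y, hy⟩
    have h := DFunLike.congr_fun hy 1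
    rw [Finsupp.mapDomain_of_notMem_range _ _ (by simp)] at h
    simp at h
    omega

theorem map_constantCoeff_iterEquiv (f : Germ) :
    (iterEquiv f).map PowerSeries.constantCoeff = restr 1 f := by
  ext n
  rw [PowerSeries.coeff_map, coeff_restr, ← PowerSeries.coeff_zero_eq_constantCoeff_apply,
    coeff_coeff_iterEquiv]
  simp

theorem constantCoeff_iterEquiv (f : Germ) :
    PowerSeries.constantCoeff (iterEquiv f) = restr 0 f := by
  ext n
  rw [coeff_restr, ← PowerSeries.coeff_zero_eq_constantCoeff_apply, coeff_coeff_iterEquiv]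
  simp

/-! ### Polynomials in `v` over `ℂ⟦u⟧` -/

open Polynomial in
/-- A polynomial in `v` with coefficients in `ℂ⟦u⟧`, as a germ. -/
noncomputable def polyGerm : (PowerSeries ℂ)[X] →+* Germ :=
  (iterEquiv.symm : PowerSeries (PowerSeries ℂ) →+* Germ).comp coeToPowerSeries.ringHom

theorem iterEquiv_polyGerm (P : Polynomial (PowerSeries ℂ)) :
    iterEquiv (polyGerm P) = (P : PowerSeries (PowerSeries ℂ)) :=
  iterEquiv.apply_symm_apply _

theorem polyGerm_X : polyGerm Polynomial.X = MvPowerSeries.X 1 := by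
  apply iterEquiv.injective
  rw [iterEquiv_polyGerm, iterEquiv_X_one, Polynomial.coe_X]

theorem polyGerm_C (a : PowerSeries ℂ) : polyGerm (Polynomial.C a) = a.toMvPowerSeries 0 := by
  apply iterEquiv.injective
  rw [iterEquiv_polyGerm, iterEquiv_toMvPowerSeries, Polynomial.coe_C]

theorem polyGerm_C_X : polyGerm (Polynomial.C PowerSeries.X) = MvPowerSeries.X 0 := by
  rw [polyGerm_C, PowerSeries.toMvPowerSeries_X]

theorem polyGerm_C_C (t : ℂ) :
    polyGerm (Polynomial.C (PowerSeries.C t)) = MvPowerSeries.C t := by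
  rw [polyGerm_C, PowerSeries.toMvPowerSeries_C]

theorem restr_one_polyGerm (P : Polynomial (PowerSeries ℂ)) :
    restr 1 (polyGerm P) = ((P.map PowerSeries.constantCoeff : Polynomial ℂ) : PowerSeries ℂ) := by
  rw [← map_constantCoeff_iterEquiv, iterEquiv_polyGerm, Polynomial.polynomial_map_coe]

theorem restr_zero_polyGerm (P : Polynomial (PowerSeries ℂ)) :
    restr 0 (polyGerm P) = P.coeff 0 := by
  rw [← constantCoeff_iterEquiv, iterEquiv_polyGerm, Polynomial.constantCoeff_coe]

/-! ### Weierstrass preparation and division for germs -/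

instance : IsAdicComplete (IsLocalRing.maximalIdeal (PowerSeries ℂ)) (PowerSeries ℂ) := by
  rw [PowerSeries.maximalIdeal_eq_span_X]
  infer_instance

/-- `P` is a Weierstrass polynomial in `v`: it is monic, and its other coefficients vanish
at `u = 0`. -/
abbrev IsWeierstrassPoly (P : Polynomial (PowerSeries ℂ)) : Prop :=
  P.IsDistinguishedAt (IsLocalRing.maximalIdeal (PowerSeries ℂ))

theorem mem_maximalIdeal_iff (a : PowerSeries ℂ) :
    a ∈ IsLocalRing.maximalIdeal (PowerSeries ℂ) ↔ PowerSeries.constantCoeff a = 0 := by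
  rw [PowerSeries.maximalIdeal_eq_span_X, Ideal.mem_span_singleton, PowerSeries.X_dvd_iff]

theorem IsWeierstrassPoly.restr_one {G : Polynomial (PowerSeries ℂ)} (hG : IsWeierstrassPoly G) :
    restr 1 (polyGerm G) = PowerSeries.X ^ G.natDegree := by
  rw [restr_one_polyGerm]
  have : G.map PowerSeries.constantCoeff = Polynomial.X ^ G.natDegree := by
    ext i
    rw [Polynomial.coeff_map, Polynomial.coeff_X_pow]
    split_ifs with h
    · rw [h, hG.monic.coeff_natDegree, map_one]
    · rcases lt_or_gt_of_ne h with h | h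
      · exact (mem_maximalIdeal_iff _).mp (hG.mem h)
      · rw [Polynomial.coeff_eq_zero_of_natDegree_lt h, map_zero]
  rw [this, Polynomial.coe_pow, Polynomial.coe_X]

theorem IsWeierstrassPoly.axisOrder_one {G : Polynomial (PowerSeries ℂ)}
    (hG : IsWeierstrassPoly G) : axisOrder 1 (polyGerm G) = G.natDegree := by
  rw [axisOrder, hG.restr_one, PowerSeries.order_X_pow]

/-- The hypothesis of the Weierstrass division theorem. -/
theorem IsWeierstrassPoly.map_residue_ne_zero {G : Polynomial (PowerSeries ℂ)}
    (hG : IsWeierstrassPoly G) :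
    (G : PowerSeries (PowerSeries ℂ)).map (IsLocalRing.residue (PowerSeries ℂ)) ≠ 0 :=
  hG.map_ne_zero_of_eq_mul G 1 (by simp) (by simp)

theorem IsWeierstrassPoly.order_map_residue {G : Polynomial (PowerSeries ℂ)}
    (hG : IsWeierstrassPoly G) :
    ((G : PowerSeries (PowerSeries ℂ)).map (IsLocalRing.residue (PowerSeries ℂ))).order.toNat =
      G.natDegree := by
  have := hG.coe_natDegree_eq_order_map (G : PowerSeries (PowerSeries ℂ)) 1 (by simp) (by simp)
  exact (congrArg ENat.toNat this.symm).trans (ENat.toNat_natCast _)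

/-- Weierstrass preparation. -/
theorem exists_eq_polyGerm_mul {g : Germ} (hg : ¬ MvPowerSeries.X 0 ∣ g) :
    ∃ (G : Polynomial (PowerSeries ℂ)) (U : Germ),
      IsWeierstrassPoly G ∧ IsUnit U ∧ g = polyGerm G * U := by
  have h : (iterEquiv g).map (IsLocalRing.residue (PowerSeries ℂ)) ≠ 0 := by
    intro h
    apply hg
    rw [← axisOrder_eq_top_iff 1 0 (by decide), axisOrder, PowerSeries.order_eq_top,
      ← map_constantCoeff_iterEquiv]
    ext n
    have hn := PowerSeries.ext_iff.mp h n
    rw [PowerSeries.coeff_map, map_zero, IsLocalRing.residue_eq_zero_iff,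
      mem_maximalIdeal_iff] at hn
    rw [PowerSeries.coeff_map, hn, map_zero]
  obtain ⟨G, U, H⟩ := PowerSeries.exists_isWeierstrassFactorization h
  refine ⟨G, iterEquiv.symm U, H.isDistinguishedAt, H.isUnit.map iterEquiv.symm, ?_⟩
  apply iterEquiv.injective
  rw [map_mul, iterEquiv_polyGerm, iterEquiv.apply_symm_apply, H.eq_mul]

/-- Weierstrass division. -/
theorem IsWeierstrassPoly.exists_division {G : Polynomial (PowerSeries ℂ)}
    (hG : IsWeierstrassPoly G) (f : Germ) :
    ∃ (q : Germ) (R : Polynomial (PowerSeries ℂ)),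
      R.degree < G.natDegree ∧ f = polyGerm G * q + polyGerm R := by
  obtain ⟨q, R, H⟩ := PowerSeries.exists_isWeierstrassDivision (iterEquiv f) hG.map_residue_ne_zero
  refine ⟨iterEquiv.symm q, R, ?_, ?_⟩
  · exact lt_of_lt_of_eq H.degree_lt (congrArg _ hG.order_map_residue)
  · apply iterEquiv.injective
    rw [map_add, map_mul, iterEquiv_polyGerm, iterEquiv_polyGerm, iterEquiv.apply_symm_apply,
      H.eq_mul_add]

/-- Uniqueness in Weierstrass division. -/
theorem IsWeierstrassPoly.eq_zero_of_dvd {G R : Polynomial (PowerSeries ℂ)}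
    (hG : IsWeierstrassPoly G) (hR : R.degree < G.natDegree) (h : polyGerm G ∣ polyGerm R) :
    R = 0 := by
  obtain ⟨q, hq⟩ := h
  have hq' := congrArg iterEquiv hq
  rw [map_mul, iterEquiv_polyGerm, iterEquiv_polyGerm] at hq'
  have hdeg : ∀ {P : Polynomial (PowerSeries ℂ)}, P.degree < G.natDegree → P.degree <
      ((G : PowerSeries (PowerSeries ℂ)).map
        (Ideal.Quotient.mk (IsLocalRing.maximalIdeal (PowerSeries ℂ)))).order.toNat := fun hP =>
    lt_of_lt_of_eq hP (congrArg _ hG.order_map_residue.symm)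
  have H1 : PowerSeries.IsWeierstrassDivision (R : PowerSeries (PowerSeries ℂ)) G 0 R :=
    ⟨hdeg hR, by simp⟩
  have H2 : PowerSeries.IsWeierstrassDivision (R : PowerSeries (PowerSeries ℂ)) G (iterEquiv q) 0 :=
    ⟨hdeg (by simp), by simpa using hq'⟩
  exact (H1.elim hG.map_residue_ne_zero H2).2

/-! ### Total and strict transforms -/

theorem totalTransform_eq (t : OnePoint ℂ) (f : Germ) :
    totalTransform t f = MvPowerSeries.substAlgHom (hasSubst_chart t) f :=
  (MvPowerSeries.substAlgHom_apply (hasSubst_chart t) f).symm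

theorem totalTransform_mul (t : OnePoint ℂ) (f g : Germ) :
    totalTransform t (f * g) = totalTransform t f * totalTransform t g := by
  simp only [totalTransform_eq, map_mul]

theorem totalTransform_add (t : OnePoint ℂ) (f g : Germ) :
    totalTransform t (f + g) = totalTransform t f + totalTransform t g := by
  simp only [totalTransform_eq, map_add]

theorem totalTransform_pow (t : OnePoint ℂ) (f : Germ) (n : ℕ) :
    totalTransform t (f ^ n) = totalTransform t f ^ n := by
  simp only [totalTransform_eq, map_pow]

theorem totalTransform_X (t : OnePoint ℂ) (i : Fin 2) :
    totalTransform t (MvPowerSeries.X i) = chart t i :=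
  MvPowerSeries.subst_X (hasSubst_chart t) i

theorem constantCoeff_totalTransform (t : OnePoint ℂ) (f : Germ) :
    MvPowerSeries.constantCoeff (totalTransform t f) = MvPowerSeries.constantCoeff f := by
  have h : totalTransform t (f - MvPowerSeries.C (MvPowerSeries.constantCoeff f)) =
      totalTransform t f - MvPowerSeries.C (MvPowerSeries.constantCoeff f) := by
    rw [totalTransform, MvPowerSeries.subst_sub (hasSubst_chart t),
      MvPowerSeries.subst_C]
    rfl
  have h0 : MvPowerSeries.constantCoeff (totalTransform t
      (f - MvPowerSeries.C (MvPowerSeries.constantCoeff f))) = 0 := by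
    apply MvPowerSeries.constantCoeff_subst_eq_zero (hasSubst_chart t)
    · intro i
      rcases t with _ | t <;> fin_cases i <;> simp [chart]
    · simp
  rw [h] at h0
  simpa [sub_eq_zero] using h0

theorem isUnit_totalTransform {f : Germ} (t : OnePoint ℂ) (hf : IsUnit f) :
    IsUnit (totalTransform t f) := by
  rw [isUnit_iff_constantCoeff_ne_zero] at hf ⊢
  rwa [constantCoeff_totalTransform]

theorem totalTransform_polyGerm (t : ℂ) (P : Polynomial (PowerSeries ℂ)) :
    totalTransform t (polyGerm P) = polyGerm (P.comp
      (Polynomial.C PowerSeries.X * (Polynomial.X + Polynomial.C (PowerSeries.C t)))) := by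
  have : ((MvPowerSeries.substAlgHom (hasSubst_chart t) : Germ →ₐ[ℂ] Germ) : Germ →+* Germ).comp
      polyGerm = polyGerm.comp (Polynomial.compRingHom
      (Polynomial.C PowerSeries.X * (Polynomial.X + Polynomial.C (PowerSeries.C t)))) := by
    apply Polynomial.ringHom_ext
    · intro a
      simp only [RingHom.comp_apply, RingHom.coe_coe, Polynomial.coe_compRingHom_apply,
        Polynomial.C_comp]
      rw [← totalTransform_eq, polyGerm_C, totalTransform,
        PowerSeries.subst_toMvPowerSeries (hasSubst_chart t), chart_coe,
        PowerSeries.toMvPowerSeries_eq_subst]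
      rfl
    · simp only [RingHom.comp_apply, RingHom.coe_coe, Polynomial.coe_compRingHom_apply,
        Polynomial.X_comp]
      rw [← totalTransform_eq, polyGerm_X, totalTransform_X, map_mul, map_add, polyGerm_C_X,
        polyGerm_X, polyGerm_C_C, chart_coe]
      rfl
  rw [totalTransform_eq]
  exact RingHom.congr_fun this P

theorem divExceptional_X_pow_mul (m : ℕ) (g : Germ) :
    divExceptional m (MvPowerSeries.X 0 ^ m * g) = g := by
  ext e
  have h1 : MvPowerSeries.coeff e (divExceptional m (MvPowerSeries.X 0 ^ m * g)) =
      MvPowerSeries.coeff (e + Finsupp.single 0 m) (MvPowerSeries.X 0 ^ m * g) := rfl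
  rw [h1, MvPowerSeries.X_pow_eq, add_comm, MvPowerSeries.coeff_add_monomial_mul, one_mul]

theorem isUnit_strictTransform₁ {f : Germ} (t : OnePoint ℂ) (hf : IsUnit f) :
    IsUnit (strictTransform₁ f t) := by
  have h := X_pow_mul_strictTransform₁ f t
  rw [order_eq_zero_of_isUnit hf] at h
  simp only [ENat.toNat_zero, pow_zero, one_mul] at h
  rw [h]
  exact isUnit_totalTransform t hf

/-! ### The strict transform of a germ at a finite direction -/

/-- The polynomial in `X = v / u` defined by the leading form of the germ. Its roots are the finite
tangent directions. -/
noncomputable def leadPoly (f : Germ) : Polynomial ℂ :=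
  ∑ j ∈ Finset.range (f.order.toNat + 1), Polynomial.C (MvPowerSeries.coeff
    (Finsupp.single 0 (f.order.toNat - j) + Finsupp.single 1 j) f) * Polynomial.X ^ j

theorem coeff_leadPoly (f : Germ) {j : ℕ} (hj : j ≤ f.order.toNat) :
    (leadPoly f).coeff j = MvPowerSeries.coeff
      (Finsupp.single 0 (f.order.toNat - j) + Finsupp.single 1 j) f := by
  simp only [leadPoly, Polynomial.finsetSum_coeff, Polynomial.coeff_C_mul_X_pow]
  rw [Finset.sum_ite_eq, if_pos (by simpa using Nat.lt_succ_of_le hj)]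

theorem fin_two_exponent (d : Fin 2 →₀ ℕ) :
    d = Finsupp.single 0 (d 0) + Finsupp.single 1 (d 1) := by
  ext i
  fin_cases i <;> simp

theorem leadPoly_ne_zero {f : Germ} (hf : f ≠ 0) : leadPoly f ≠ 0 := by
  obtain ⟨d, hd, hdeg⟩ := MvPowerSeries.exists_coeff_ne_zero_and_order (coe_toNat_order hf)
  have hdeg' : d 0 + d 1 = f.order.toNat := by
    rw [← hdeg, ENat.toNat_natCast, Finsupp.degree_eq_sum, Fin.sum_univ_two]
  intro h0
  apply hd
  have := coeff_leadPoly f (j := d 1) (by omega)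
  rw [h0, Polynomial.coeff_zero, show f.order.toNat - d 1 = d 0 by omega,
    ← fin_two_exponent] at this
  exact this.symm

theorem coeff_X_pow_mul_linear_pow (n j a b : ℕ) (t : ℂ) :
    MvPowerSeries.coeff (Finsupp.single 0 a + Finsupp.single 1 b)
      ((MvPowerSeries.X 0 : Germ) ^ n * (MvPowerSeries.X 1 + MvPowerSeries.C t) ^ j) =
      if a = n then ((Polynomial.X + Polynomial.C t) ^ j : Polynomial ℂ).coeff b else 0 := by
  have h : (MvPowerSeries.X 0 : Germ) ^ n * (MvPowerSeries.X 1 + MvPowerSeries.C t) ^ j =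
      polyGerm (Polynomial.C (PowerSeries.X ^ n) *
        ((Polynomial.X + Polynomial.C t) ^ j : Polynomial ℂ).map PowerSeries.C) := by
    simp only [map_mul, map_pow, polyGerm_C_X, Polynomial.map_pow, Polynomial.map_add,
      Polynomial.map_X, Polynomial.map_C, map_add, polyGerm_X, polyGerm_C_C]
  rw [h, ← coeff_coeff_iterEquiv, iterEquiv_polyGerm, Polynomial.coeff_coe, Polynomial.coeff_C_mul,
    Polynomial.coeff_map, PowerSeries.coeff_mul_C, PowerSeries.coeff_X_pow]
  split_ifs <;> simp

/-- The coefficient of `u ^ a v ^ b` in the total transform involves only the homogeneous part of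
degree `a` of the germ. -/
theorem coeff_totalTransform (t : ℂ) (f : Germ) (a b : ℕ) :
    MvPowerSeries.coeff (Finsupp.single 0 a + Finsupp.single 1 b) (totalTransform t f) =
      ∑ j ∈ Finset.range (a + 1),
        MvPowerSeries.coeff (Finsupp.single 0 (a - j) + Finsupp.single 1 j) f *
          ((Polynomial.X + Polynomial.C t) ^ j : Polynomial ℂ).coeff b := by
  have hterm : ∀ d : Fin 2 →₀ ℕ, MvPowerSeries.coeff (Finsupp.single 0 a + Finsupp.single 1 b)
      (d.prod fun s e => chart t s ^ e) = if a = d 0 + d 1 then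
        ((Polynomial.X + Polynomial.C t) ^ d 1 : Polynomial ℂ).coeff b else 0 := by
    intro d
    rw [← coeff_X_pow_mul_linear_pow, Finsupp.prod_fintype _ _ (by simp), Fin.prod_univ_two,
      chart_coe]
    congr 1
    simp only [Matrix.cons_val_zero, Matrix.cons_val_one]
    rw [mul_pow, pow_add, mul_assoc]
  rw [totalTransform, MvPowerSeries.coeff_subst (hasSubst_chart t)]
  simp only [hterm]
  classical
  rw [finsum_eq_sum_of_support_subset (s := (Finset.range (a + 1)).image fun j =>
    (Finsupp.single 0 (a - j) + Finsupp.single 1 j : Fin 2 →₀ ℕ))]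
  · rw [Finset.sum_image]
    · refine Finset.sum_congr rfl fun j hj => ?_
      rw [Finset.mem_range] at hj
      have : a - j + j = a := by omega
      simp [this]
    · intro j _ j' _ h
      simpa using DFunLike.congr_fun h 1
  · intro d hd
    rw [Function.mem_support] at hd
    have had : a = d 0 + d 1 := by
      by_contra h
      simp [h] at hd
    simp only [Finset.coe_image, Set.mem_image, Finset.coe_range, Set.mem_Iio]
    refine ⟨d 1, by omega, ?_⟩
    rw [show a - d 1 = d 0 by omega, ← fin_two_exponent]

/-- On the exceptional divisor the strict transform is given by the leading form. -/
theorem restr_one_strictTransform₁ (t : ℂ) (f : Germ) :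
    restr 1 (strictTransform₁ f t) =
      ((leadPoly f).comp (Polynomial.X + Polynomial.C t) : Polynomial ℂ) := by
  ext b
  have h : PowerSeries.coeff b (restr 1 (strictTransform₁ f t)) = MvPowerSeries.coeff
      (Finsupp.single 0 f.order.toNat + Finsupp.single 1 b) (totalTransform t f) := by
    rw [coeff_restr, add_comm]
    rfl
  rw [h, coeff_totalTransform, Polynomial.coeff_coe, leadPoly, ← Polynomial.coe_compRingHom_apply,
    map_sum, Polynomial.finsetSum_coeff]
  refine Finset.sum_congr rfl fun j _ => ?_
  rw [Polynomial.coe_compRingHom_apply, Polynomial.mul_comp, Polynomial.C_comp,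
    Polynomial.pow_comp, Polynomial.X_comp, Polynomial.coeff_C_mul]

theorem X_not_dvd_strictTransform₁ (t : ℂ) {f : Germ} (hf : f ≠ 0) :
    ¬ MvPowerSeries.X 0 ∣ strictTransform₁ f t := by
  rw [← axisOrder_eq_top_iff 1 0 (by decide), axisOrder, PowerSeries.order_eq_top,
    restr_one_strictTransform₁]
  intro h
  have h' : (leadPoly f).comp (Polynomial.X + Polynomial.C t) = 0 := by exact_mod_cast h
  apply leadPoly_ne_zero hf
  have h2 := congrArg (fun P => P.comp (Polynomial.X - Polynomial.C t)) h'
  simpa [Polynomial.comp_assoc] using h2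

theorem restr_zero_totalTransform_zero (f : Germ) :
    restr 0 (totalTransform (0 : ℂ) f) = restr 0 f := by
  ext a
  rw [coeff_restr, coeff_restr]
  have h := coeff_totalTransform 0 f a 0
  rw [Finsupp.single_zero, add_zero] at h
  rw [h, Finset.sum_eq_single 0]
  · simp
  · intro j _ hj
    simp [hj.symm, Polynomial.coeff_X_pow]
  · simp

/-- Noether's formula for the intersection with the axis `v = 0`, whose strict transform passes
through the point of direction `0`. -/
theorem axisOrder_zero_eq_add {f : Germ} (hf : f ≠ 0) :
    axisOrder 0 f = f.order + axisOrder 0 (strictTransform₁ f (0 : ℂ)) := by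
  rw [axisOrder, ← restr_zero_totalTransform_zero, ← X_pow_mul_strictTransform₁, map_mul, map_pow,
    restr_X_self, PowerSeries.order_mul, PowerSeries.order_X_pow, coe_toNat_order hf]
  rfl

/-! ### The strict transform of an irreducible germ -/

theorem X_zero_ne_zero : (MvPowerSeries.X 0 : Germ) ≠ 0 := by
  intro h
  have := congrArg (restr 0) h
  rw [restr_X_self, map_zero] at this
  exact PowerSeries.X_ne_zero this

/-- The substitution `v = u (v' + t)` turns the polynomial `u ^ N G (v / u - t)`, with
`N = natDegree G`, into `u ^ N G (v')`. -/
theorem totalTransform_polyGerm_scaleRoots (t : ℂ) (G : Polynomial (PowerSeries ℂ)) :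
    totalTransform t (polyGerm ((G.comp (Polynomial.X - Polynomial.C (PowerSeries.C t))).scaleRoots
      PowerSeries.X)) = MvPowerSeries.X 0 ^ G.natDegree * polyGerm G := by
  have h := Polynomial.scaleRoots_eval₂_mul
    (p := G.comp (Polynomial.X - Polynomial.C (PowerSeries.C t)))
    (Polynomial.C : PowerSeries ℂ →+* _) (Polynomial.X + Polynomial.C (PowerSeries.C t))
    PowerSeries.X
  rw [totalTransform_polyGerm, Polynomial.comp, h, map_mul, map_pow, polyGerm_C_X,
    Polynomial.natDegree_comp, Polynomial.natDegree_X_sub_C, mul_one, ← Polynomial.comp,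
    Polynomial.comp_assoc]
  simp

theorem isWeierstrassPoly_scaleRoots {H : Polynomial (PowerSeries ℂ)} (hH : H.Monic) :
    IsWeierstrassPoly (H.scaleRoots PowerSeries.X) := by
  refine ⟨⟨fun {i} hi => ?_⟩, (Polynomial.monic_scaleRoots_iff _).mpr hH⟩
  rw [Polynomial.natDegree_scaleRoots] at hi
  rw [Polynomial.coeff_scaleRoots, mem_maximalIdeal_iff, map_mul, map_pow,
    PowerSeries.constantCoeff_X, zero_pow (by omega), mul_zero]

/-- A Weierstrass polynomial dividing the strict transform of `f` at the direction `t` blows down to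
a Weierstrass polynomial that divides `f`. -/
theorem polyGerm_scaleRoots_dvd {f : Germ} (t : ℂ) {G : Polynomial (PowerSeries ℂ)}
    (hG : IsWeierstrassPoly G) (hdvd : polyGerm G ∣ strictTransform₁ f t) :
    polyGerm ((G.comp (Polynomial.X - Polynomial.C (PowerSeries.C t))).scaleRoots
      PowerSeries.X) ∣ f := by
  have hHmonic : (G.comp (Polynomial.X - Polynomial.C (PowerSeries.C t))).Monic :=
    hG.monic.comp_X_sub_C _
  have hW := isWeierstrassPoly_scaleRoots hHmonic
  obtain ⟨q, R, hR, hfqR⟩ := hW.exists_division f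
  rw [Polynomial.natDegree_scaleRoots, Polynomial.natDegree_comp, Polynomial.natDegree_X_sub_C,
    mul_one] at hR
  set ℓ : Polynomial (PowerSeries ℂ) :=
    Polynomial.C PowerSeries.X * (Polynomial.X + Polynomial.C (PowerSeries.C t)) with hℓ
  have hℓdeg : ℓ.natDegree = 1 := by
    rw [hℓ, Polynomial.natDegree_C_mul PowerSeries.X_ne_zero, Polynomial.natDegree_X_add_C]
  -- the remainder of the division of `f` pulls back to a multiple of `G` of smaller degree
  have hdvd' : polyGerm G ∣ polyGerm (R.comp ℓ) := by
    have h := (X_pow_mul_strictTransform₁ f t).trans (congrArg (totalTransform t) hfqR)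
    rw [totalTransform_add, totalTransform_mul, totalTransform_polyGerm_scaleRoots,
      totalTransform_polyGerm] at h
    rw [← hℓ] at h
    rw [eq_sub_of_add_eq' h.symm]
    exact dvd_sub (hdvd.mul_left _) (((dvd_refl _).mul_left _).mul_right _)
  have hdeg : (R.comp ℓ).degree < G.natDegree := by
    rcases eq_or_ne R 0 with rfl | hR0
    · simp
    · refine lt_of_le_of_lt Polynomial.degree_le_natDegree ?_
      rw [Polynomial.natDegree_comp, hℓdeg, mul_one, ← Polynomial.degree_eq_natDegree hR0]
      exact hR
  have h0 := hG.eq_zero_of_dvd hdeg hdvd'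
  rw [Polynomial.comp_eq_zero_iff] at h0
  have hR0 : R = 0 := by
    rcases h0 with h0 | ⟨-, h0⟩
    · exact h0
    · rw [h0, Polynomial.natDegree_C] at hℓdeg
      omega
  rw [hfqR, hR0, map_zero, add_zero]
  exact dvd_mul_right _ _

/-- A non-unit factor of the strict transform of an irreducible germ is, up to a unit, a Weierstrass
polynomial that blows down to the germ itself. -/
theorem exists_weierstrass_of_dvd_strictTransform₁ {f g : Germ} (hf : Irreducible f) (t : ℂ)
    (hg : g ∣ strictTransform₁ f t) (hgu : ¬ IsUnit g) :
    ∃ G : Polynomial (PowerSeries ℂ), IsWeierstrassPoly G ∧ f.order = G.natDegree ∧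
      Associated g (polyGerm G) ∧ Associated (strictTransform₁ f t) (polyGerm G) ∧
      Associated f (polyGerm ((G.comp (Polynomial.X - Polynomial.C (PowerSeries.C t))).scaleRoots
        PowerSeries.X)) := by
  have hX := X_not_dvd_strictTransform₁ t hf.ne_zero
  obtain ⟨G, U, hG, hU, hgG⟩ := exists_eq_polyGerm_mul fun h => hX (h.trans hg)
  have hassoc : Associated g (polyGerm G) := by
    rw [hgG]
    exact (associated_mul_isUnit_left_iff hU).mpr (Associated.refl _)
  have hdeg : G.natDegree ≠ 0 := by
    intro h
    rw [hG.monic.natDegree_eq_zero] at h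
    rw [h, map_one, one_mul] at hgG
    exact hgu (hgG ▸ hU)
  have hGX : ¬ MvPowerSeries.X 0 ∣ polyGerm G := fun h => hX ((h.trans hassoc.symm.dvd).trans hg)
  obtain ⟨c, hc⟩ := polyGerm_scaleRoots_dvd t hG (hassoc.symm.dvd.trans hg)
  set W := (G.comp (Polynomial.X - Polynomial.C (PowerSeries.C t))).scaleRoots
    PowerSeries.X with hWdef
  have hW : IsWeierstrassPoly W := isWeierstrassPoly_scaleRoots (hG.monic.comp_X_sub_C _)
  have hWdeg : W.natDegree = G.natDegree := by
    rw [hWdef, Polynomial.natDegree_scaleRoots, Polynomial.natDegree_comp,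
      Polynomial.natDegree_X_sub_C, mul_one]
  have hWu : ¬ IsUnit (polyGerm W) := by
    rw [← axisOrder_eq_zero_iff 1, hW.axisOrder_one, hWdeg]
    exact_mod_cast hdeg
  have hcu : IsUnit c := (hf.isUnit_or_isUnit hc).resolve_left hWu
  have hcu' := isUnit_totalTransform t hcu
  have htt : MvPowerSeries.X 0 ^ f.order.toNat * strictTransform₁ f t =
      MvPowerSeries.X 0 ^ G.natDegree * (polyGerm G * totalTransform t c) := by
    rw [X_pow_mul_strictTransform₁, ← mul_assoc, ← totalTransform_polyGerm_scaleRoots, ← hWdef,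
      ← totalTransform_mul, ← hc]
  have hX0 : ∀ m : ℕ, (MvPowerSeries.X 0 : Germ) ^ m ≠ 0 := fun m =>
    pow_ne_zero _ X_zero_ne_zero
  -- neither `G` nor the strict transform is divisible by `u`, so the powers of `u` agree
  have hord : f.order.toNat = G.natDegree := by
    rcases lt_trichotomy f.order.toNat G.natDegree with h | h | h
    · exfalso
      obtain ⟨e, he⟩ := Nat.exists_eq_add_of_lt h
      rw [he, add_assoc, pow_add, mul_assoc] at htt
      apply hX
      rw [mul_left_cancel₀ (hX0 _) htt, pow_succ]
      exact ((dvd_mul_left _ _).mul_right _)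
    · exact h
    · exfalso
      obtain ⟨e, he⟩ := Nat.exists_eq_add_of_lt h
      rw [he, add_assoc, pow_add, mul_assoc] at htt
      have h2 := mul_left_cancel₀ (hX0 _) htt
      apply hGX
      rw [← hcu'.dvd_mul_right, ← h2, pow_succ]
      exact ((dvd_mul_left _ _).mul_right _)
  rw [hord] at htt
  refine ⟨G, hG, ?_, hassoc, ?_, ?_⟩
  · rw [← coe_toNat_order hf.ne_zero, hord]
  · rw [mul_left_cancel₀ (hX0 _) htt]
    exact (associated_mul_isUnit_left_iff hcu').mpr (Associated.refl _)
  · rw [hc]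
    exact (associated_mul_isUnit_left_iff hcu).mpr (Associated.refl _)

theorem axisOrder_congr (i : Fin 2) {f g : Germ} (h : Associated f g) :
    axisOrder i f = axisOrder i g := by
  obtain ⟨U, rfl⟩ := h
  rw [axisOrder_mul, (axisOrder_eq_zero_iff i _).mpr U.isUnit, add_zero]

theorem irreducible_strictTransform₁_coe {f : Germ} (hf : Irreducible f) (t : ℂ)
    (hu : ¬ IsUnit (strictTransform₁ f t)) : Irreducible (strictTransform₁ f t) := by
  refine ⟨hu, fun a b hab => ?_⟩
  by_contra! hcon
  obtain ⟨G, hG, hfG, haG, hsG, -⟩ :=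
    exists_weierstrass_of_dvd_strictTransform₁ hf t ⟨b, hab⟩ hcon.1
  have h1 : axisOrder 1 (strictTransform₁ f t) = axisOrder 1 a :=
    (axisOrder_congr 1 hsG).trans (axisOrder_congr 1 haG).symm
  have h2 : axisOrder 1 a ≠ ⊤ := by
    rw [axisOrder_congr 1 haG, hG.axisOrder_one]
    exact ENat.natCast_ne_top _
  rw [hab, axisOrder_mul] at h1
  apply hcon.2
  rw [← axisOrder_eq_zero_iff 1]
  exact ENat.add_right_injective_of_ne_top h2 (by simpa using h1)

/-- The strict transform of an irreducible germ meets the exceptional divisor at one point, with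
multiplicity the multiplicity of the germ. -/
theorem axisOrder_one_strictTransform₁_coe {f : Germ} (hf : Irreducible f) (t : ℂ)
    (hu : ¬ IsUnit (strictTransform₁ f t)) :
    axisOrder 1 (strictTransform₁ f t) = f.order := by
  obtain ⟨G, hG, hfG, -, hsG, -⟩ :=
    exists_weierstrass_of_dvd_strictTransform₁ hf t dvd_rfl hu
  rw [axisOrder_congr 1 hsG, hG.axisOrder_one, hfG]

/-- An irreducible germ with a finite tangent direction is not tangent to `u = 0`. -/
theorem axisOrder_one_eq_order {f : Germ} (hf : Irreducible f) (t : ℂ)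
    (hu : ¬ IsUnit (strictTransform₁ f t)) : axisOrder 1 f = f.order := by
  obtain ⟨G, hG, hfG, -, -, hfW⟩ :=
    exists_weierstrass_of_dvd_strictTransform₁ hf t dvd_rfl hu
  rw [axisOrder_congr 1 hfW,
    (isWeierstrassPoly_scaleRoots (hG.monic.comp_X_sub_C _)).axisOrder_one, hfG,
    Polynomial.natDegree_scaleRoots, Polynomial.natDegree_comp, Polynomial.natDegree_X_sub_C,
    mul_one]

/-- An irreducible germ with a nonzero tangent direction is not tangent to `v = 0`. -/
theorem axisOrder_zero_eq_order {f : Germ} (hf : Irreducible f) {t : ℂ} (ht : t ≠ 0)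
    (hu : ¬ IsUnit (strictTransform₁ f t)) : axisOrder 0 f = f.order := by
  obtain ⟨G, hG, hfG, -, -, hfW⟩ :=
    exists_weierstrass_of_dvd_strictTransform₁ hf t dvd_rfl hu
  have hmap : G.map PowerSeries.constantCoeff = Polynomial.X ^ G.natDegree := by
    have h := hG.restr_one
    rw [restr_one_polyGerm, ← Polynomial.coe_X, ← Polynomial.coe_pow] at h
    exact_mod_cast h
  have hev : PowerSeries.constantCoeff ((G.comp (Polynomial.X -
      Polynomial.C (PowerSeries.C t))).coeff 0) ≠ 0 := by
    rw [Polynomial.coeff_zero_eq_eval_zero, Polynomial.eval_comp, Polynomial.eval_sub,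
      Polynomial.eval_X, Polynomial.eval_C, zero_sub, ← Polynomial.eval_map_apply, hmap]
    simp [ht]
  rw [axisOrder_congr 0 hfW, hfG, axisOrder, restr_zero_polyGerm, Polynomial.coeff_scaleRoots,
    PowerSeries.order_mul, PowerSeries.order_X_pow, Polynomial.natDegree_comp,
    Polynomial.natDegree_X_sub_C, mul_one, tsub_zero]
  rw [PowerSeries.order_zero_of_unit
    (PowerSeries.isUnit_iff_constantCoeff.mpr hev.isUnit), zero_add]

/-! ### The vertical direction -/

/-- Exchange of the two coordinates. It reduces the direction `∞` to the direction `0`. -/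
noncomputable def swapGerm : Germ ≃ₐ[ℂ] Germ :=
  MvPowerSeries.renameEquiv ℂ (Equiv.swap 0 1)

theorem coeff_swapGerm (f : Germ) (i j : ℕ) :
    MvPowerSeries.coeff (Finsupp.single 0 i + Finsupp.single 1 j) (swapGerm f) =
      MvPowerSeries.coeff (Finsupp.single 0 j + Finsupp.single 1 i) f := by
  have h := MvPowerSeries.coeff_embDomain_rename (Equiv.swap (0 : Fin 2) 1).toEmbedding f
    (Finsupp.single 0 j + Finsupp.single 1 i)
  rw [← h]
  congr 2
  ext k
  fin_cases k <;> simp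

theorem axisOrder_one_swapGerm (f : Germ) : axisOrder 1 (swapGerm f) = axisOrder 0 f := by
  have : restr 1 (swapGerm f) = restr 0 f := by
    ext n
    have := coeff_swapGerm f 0 n
    simpa [coeff_restr] using this
  rw [axisOrder, this, axisOrder]

theorem axisOrder_zero_swapGerm (f : Germ) : axisOrder 0 (swapGerm f) = axisOrder 1 f := by
  have : restr 0 (swapGerm f) = restr 1 f := by
    ext n
    have := coeff_swapGerm f n 0
    simpa [coeff_restr] using this
  rw [axisOrder, this, axisOrder]

theorem swapGerm_swapGerm (f : Germ) : swapGerm (swapGerm f) = f := by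
  ext d
  rw [fin_two_exponent d, coeff_swapGerm, coeff_swapGerm]

theorem order_le_order_swapGerm (f : Germ) : f.order ≤ (swapGerm f).order := by
  refine MvPowerSeries.le_order fun d hd => ?_
  rw [fin_two_exponent d, coeff_swapGerm]
  apply MvPowerSeries.coeff_of_lt_order
  refine lt_of_le_of_lt (le_of_eq ?_) hd
  simp [Finsupp.degree_eq_sum, add_comm]

theorem order_swapGerm (f : Germ) : (swapGerm f).order = f.order := by
  refine le_antisymm ?_ (order_le_order_swapGerm f)
  have := order_le_order_swapGerm (swapGerm f)
  rwa [swapGerm_swapGerm] at this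

/-- The coordinates of the chart at `∞` are those of the chart at `0`, exchanged. -/
theorem totalTransform_infty (f : Germ) :
    totalTransform OnePoint.infty f = totalTransform (0 : ℂ) (swapGerm f) := by
  have hswap : swapGerm f = f.subst (MvPowerSeries.X ∘ Equiv.swap 0 1) :=
    MvPowerSeries.rename_eq_subst (f := Equiv.swap 0 1) f
  rw [hswap, totalTransform, totalTransform,
    MvPowerSeries.subst_comp_subst_apply (MvPowerSeries.HasSubst.X_comp _) (hasSubst_chart _)]
  congr 1
  ext1 i
  rw [Function.comp_apply, MvPowerSeries.subst_X (hasSubst_chart _), chart_infty, chart_coe]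
  fin_cases i <;> simp

theorem strictTransform₁_infty (f : Germ) :
    strictTransform₁ f OnePoint.infty = strictTransform₁ (swapGerm f) (0 : ℂ) := by
  rw [strictTransform₁, strictTransform₁, order_swapGerm, totalTransform_infty]

theorem irreducible_strictTransform₁ {f : Germ} (hf : Irreducible f) (t : OnePoint ℂ)
    (hu : ¬ IsUnit (strictTransform₁ f t)) : Irreducible (strictTransform₁ f t) := by
  rcases t with _ | t
  · have h := strictTransform₁_infty f
    change ¬ IsUnit (strictTransform₁ f OnePoint.infty) at hu
    change Irreducible (strictTransform₁ f OnePoint.infty)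
    rw [h] at hu ⊢
    exact irreducible_strictTransform₁_coe
      ((MulEquiv.irreducible_iff swapGerm).mpr hf) 0 hu
  · exact irreducible_strictTransform₁_coe hf t hu

theorem axisOrder_one_strictTransform₁ {f : Germ} (hf : Irreducible f) (t : OnePoint ℂ)
    (hu : ¬ IsUnit (strictTransform₁ f t)) : axisOrder 1 (strictTransform₁ f t) = f.order := by
  rcases t with _ | t
  · have h := strictTransform₁_infty f
    change ¬ IsUnit (strictTransform₁ f OnePoint.infty) at hu
    change axisOrder 1 (strictTransform₁ f OnePoint.infty) = _
    rw [h] at hu ⊢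
    rw [axisOrder_one_strictTransform₁_coe ((MulEquiv.irreducible_iff swapGerm).mpr hf) 0 hu,
      order_swapGerm]
  · exact axisOrder_one_strictTransform₁_coe hf t hu

theorem axisOrder_zero_eq_order_of_infty {f : Germ} (hf : Irreducible f)
    (hu : ¬ IsUnit (strictTransform₁ f OnePoint.infty)) : axisOrder 0 f = f.order := by
  rw [strictTransform₁_infty] at hu
  rw [← axisOrder_one_swapGerm, axisOrder_one_eq_order
    ((MulEquiv.irreducible_iff swapGerm).mpr hf) 0 hu, order_swapGerm]

theorem axisOrder_one_eq_add {f : Germ} (hf : f ≠ 0) :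
    axisOrder 1 f = f.order + axisOrder 0 (strictTransform₁ f OnePoint.infty) := by
  rw [strictTransform₁_infty, ← axisOrder_zero_swapGerm, axisOrder_zero_eq_add, order_swapGerm]
  simpa using hf

theorem axisOrder_zero_eq_order_of_ne_zero {f : Germ} (hf : Irreducible f) {t : OnePoint ℂ}
    (ht : t ≠ ((0 : ℂ) : OnePoint ℂ)) (hu : ¬ IsUnit (strictTransform₁ f t)) :
    axisOrder 0 f = f.order := by
  rcases t with _ | t
  · exact axisOrder_zero_eq_order_of_infty hf hu
  · exact axisOrder_zero_eq_order hf (fun h => ht (h ▸ rfl)) hu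

theorem axisOrder_one_eq_order_of_ne_infty {f : Germ} (hf : Irreducible f) {t : OnePoint ℂ}
    (ht : t ≠ OnePoint.infty) (hu : ¬ IsUnit (strictTransform₁ f t)) :
    axisOrder 1 f = f.order := by
  rcases t with _ | t
  · exact absurd rfl ht
  · exact axisOrder_one_eq_order hf t hu

/-! ### Germs along a sequence of blowups -/

theorem strictTransform_append_singleton (f : Germ) (q : InfPoint) (t : OnePoint ℂ) :
    strictTransform f (q ++ [t]) = strictTransform₁ (strictTransform f q) t := by
  simp [strictTransform]

theorem passesThrough_iff (f : Germ) (q : InfPoint) :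
    PassesThrough f q ↔ ¬ IsUnit (strictTransform f q) := by
  rw [PassesThrough, isUnit_iff_constantCoeff_ne_zero, not_not]

theorem PassesThrough.of_append {f : Germ} {q r : InfPoint} (h : PassesThrough f (q ++ r)) :
    PassesThrough f q := by
  induction r using List.reverseRecOn with
  | nil => simpa using h
  | append_singleton r t ih =>
    apply ih
    rw [← List.append_assoc, passesThrough_iff, strictTransform_append_singleton] at h
    rw [passesThrough_iff]
    exact fun hu => h (isUnit_strictTransform₁ t hu)

theorem PassesThrough.irreducible {f : Germ} (hf : Irreducible f) {q : InfPoint}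
    (h : PassesThrough f q) : Irreducible (strictTransform f q) := by
  induction q using List.reverseRecOn with
  | nil => exact hf
  | append_singleton q t ih =>
    have hu := (passesThrough_iff _ _).mp h
    rw [strictTransform_append_singleton] at hu ⊢
    exact irreducible_strictTransform₁ (ih h.of_append) t hu

/-! ### The quadratic form of a path -/

/-- The role of the coordinate axes `u = 0` and `v = 0` at an infinitely near point:
* `root`: the point is `p`, where `v = 0` is the line at infinity and `u = 0` is not special;
* `line`: `u = 0` is the last exceptional divisor and `v = 0` is the strict transform of the line at
  infinity;
* `exc`: `u = 0` is the last exceptional divisor and `v = 0` is the strict transform of an earlier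
  exceptional divisor;
* `free`: `u = 0` is the last exceptional divisor and `v = 0` is not special. -/
inductive AxisKind
  | root
  | line
  | exc
  | free

namespace AxisKind

/-- The kind of the point in the direction of the axis `v = 0`, given the kind of the point blown
up. -/
def strict : AxisKind → AxisKind
  | .root => .line
  | .line => .line
  | .exc => .exc
  | .free => .free

theorem strict_eq_free_iff {k : AxisKind} : k.strict = .free ↔ k = .free := by
  cases k <;> simp [strict]

theorem strict_eq_line_iff {k : AxisKind} : k.strict = .line ↔ k = .root ∨ k = .line := by
  cases k <;> simp [strict]

theorem strict_eq_exc_iff {k : AxisKind} : k.strict = .exc ↔ k = .exc := by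
  cases k <;> simp [strict]

theorem strict_ne_root (k : AxisKind) : k.strict ≠ .root := by
  cases k <;> simp [strict]

end AxisKind

/-- The kind of an infinitely near point, with the coefficients of a quadratic form
`a x ^ 2 + b x y + c y ^ 2` in the intersection multiplicities `x` and `y` of a germ with the axes
`u = 0` and `v = 0`. -/
structure PathForm where
  kind : AxisKind
  a : ℤ
  b : ℤ
  c : ℤ

namespace PathForm

open Classical in
/-- The data at the point of direction `t`, given those at the point blown up. If `m` is the
multiplicity of a germ and `x', y'` are its intersection multiplicities with the axes after the
blowup, then `x' = m`, and `(x, y)` is `(m, m + y')` in the direction of `v = 0`, `(m + y', m)` in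
the direction of `u = 0` and `(m, m)` in all other ones. The new coefficients are those of
`a x ^ 2 + b x y + c y ^ 2 - m ^ 2` in terms of `x'` and `y'`. Only directions of special axes are
singled out. -/
noncomputable def step (s : PathForm) (t : OnePoint ℂ) : PathForm :=
  if t = ((0 : ℂ) : OnePoint ℂ) ∧ s.kind ≠ .free then
    ⟨s.kind.strict, s.a + s.b + s.c - 1, s.b + 2 * s.c, s.c⟩
  else if t = OnePoint.infty ∧ s.kind ≠ .root then
    ⟨.exc, s.a + s.b + s.c - 1, 2 * s.a + s.b, s.a⟩
  else ⟨.free, s.a + s.b + s.c - 1, 0, 0⟩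

/-- The kind and the quadratic form of an infinitely near point. At `p` the form is
`y ^ 2 = (φ_L, f)_p ^ 2`. -/
noncomputable def ofPath (q : InfPoint) : PathForm := q.foldl step ⟨.root, 0, 0, 1⟩

/-- The value of the quadratic form. -/
def eval (s : PathForm) (x y : ℤ) : ℤ := s.a * x ^ 2 + s.b * (x * y) + s.c * y ^ 2

theorem ofPath_nil : ofPath [] = ⟨.root, 0, 0, 1⟩ := rfl

theorem ofPath_append_singleton (q : InfPoint) (t : OnePoint ℂ) :
    ofPath (q ++ [t]) = (ofPath q).step t := by
  simp [ofPath]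

theorem step_zero {s : PathForm} (h : s.kind ≠ .free) :
    s.step ((0 : ℂ) : OnePoint ℂ) = ⟨s.kind.strict, s.a + s.b + s.c - 1, s.b + 2 * s.c, s.c⟩ := by
  rw [step, if_pos ⟨rfl, h⟩]

theorem step_infty {s : PathForm} (h : s.kind ≠ .root) :
    s.step OnePoint.infty = ⟨.exc, s.a + s.b + s.c - 1, 2 * s.a + s.b, s.a⟩ := by
  rw [step, if_neg (fun h => OnePoint.infty_ne_coe _ h.1), if_pos ⟨rfl, h⟩]

theorem step_of_ne {s : PathForm} {t : OnePoint ℂ}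
    (h0 : s.kind ≠ .free → t ≠ ((0 : ℂ) : OnePoint ℂ))
    (h1 : s.kind ≠ .root → t ≠ OnePoint.infty) :
    s.step t = ⟨.free, s.a + s.b + s.c - 1, 0, 0⟩ := by
  rw [step, if_neg (fun h => h0 h.2 h.1), if_neg (fun h => h1 h.2 h.1)]

/-- A direction is that of a special axis `v = 0`, that of the exceptional divisor `u = 0`, or
neither of them. -/
theorem step_trichotomy (s : PathForm) (t : OnePoint ℂ) :
    (t = ((0 : ℂ) : OnePoint ℂ) ∧ s.kind ≠ .free) ∨ (t = OnePoint.infty ∧ s.kind ≠ .root) ∨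
    ((s.kind ≠ .free → t ≠ ((0 : ℂ) : OnePoint ℂ)) ∧ (s.kind ≠ .root → t ≠ OnePoint.infty)) := by
  tauto

theorem step_kind_ne_root (s : PathForm) (t : OnePoint ℂ) : (s.step t).kind ≠ .root := by
  rw [step]
  split_ifs
  · exact AxisKind.strict_ne_root _
  · simp
  · simp

theorem eq_nil_of_kind_eq_root {q : InfPoint} (h : (ofPath q).kind = .root) : q = [] := by
  rcases List.eq_nil_or_concat' q with rfl | ⟨q', t, rfl⟩
  · rfl
  · rw [ofPath_append_singleton] at h
    exact absurd h (step_kind_ne_root _ _)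

/-- If the new point is a general point of the last exceptional divisor, then its direction is
neither the special axis nor the previous exceptional divisor. -/
theorem ne_of_step_kind_eq_free {s : PathForm} {t : OnePoint ℂ} (h : (s.step t).kind = .free) :
    (s.kind ≠ .free → t ≠ ((0 : ℂ) : OnePoint ℂ)) ∧ (s.kind ≠ .root → t ≠ OnePoint.infty) := by
  rcases s.step_trichotomy t with ⟨rfl, h1⟩ | ⟨rfl, h1⟩ | h1
  · rw [step_zero h1] at h
    exact absurd (AxisKind.strict_eq_free_iff.mp h) h1
  · rw [step_infty h1] at h
    cases h
  · exact h1

theorem step_eq_of_kind_eq_free {s : PathForm} {t : OnePoint ℂ} (h : (s.step t).kind = .free) :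
    s.step t = ⟨.free, s.a + s.b + s.c - 1, 0, 0⟩ :=
  step_of_ne (ne_of_step_kind_eq_free h).1 (ne_of_step_kind_eq_free h).2

theorem b_c_eq_zero_of_free (q : InfPoint) (h : (ofPath q).kind = .free) :
    (ofPath q).b = 0 ∧ (ofPath q).c = 0 := by
  rcases List.eq_nil_or_concat' q with rfl | ⟨q', t, rfl⟩
  · cases h
  · rw [ofPath_append_singleton] at h ⊢
    rw [step_eq_of_kind_eq_free h]
    exact ⟨rfl, rfl⟩

theorem eq_of_root (q : InfPoint) (h : (ofPath q).kind = .root) :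
    ofPath q = ⟨.root, 0, 0, 1⟩ := by
  rw [eq_nil_of_kind_eq_root h, ofPath_nil]

/-- The sign conditions that hold at the base points of a pencil. They are preserved by blowing up
except at a point of kind `free` with `a = 0`. -/
def Positive (s : PathForm) : Prop :=
  match s.kind with
  | .root => s.a = 0 ∧ s.b = 0 ∧ s.c = 1
  | .line => 0 ≤ s.a ∧ 1 ≤ s.b ∧ 1 ≤ s.c
  | .exc => 0 ≤ s.a ∧ 1 ≤ s.b ∧ 0 ≤ s.c
  | .free => 1 ≤ s.a ∧ s.b = 0 ∧ s.c = 0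

theorem Positive.step {s : PathForm} (hs : s.Positive) (t : OnePoint ℂ) :
    (s.step t).Positive ∨ (s.step t).kind = .free ∧ 0 ≤ (s.step t).a := by
  obtain ⟨k, a, b, c⟩ := s
  rcases PathForm.step_trichotomy ⟨k, a, b, c⟩ t with ⟨rfl, h1⟩ | ⟨rfl, h1⟩ | h1
  · rw [step_zero h1]
    left
    cases k <;> simp_all [Positive, AxisKind.strict] <;> omega
  · rw [step_infty h1]
    left
    cases k <;> simp_all [Positive] <;> omega
  · rw [step_of_ne h1.1 h1.2]
    right
    refine ⟨rfl, ?_⟩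
    cases k <;> simp_all [Positive] <;> omega

end PathForm

open PathForm

/-! ### The special axis is the line at infinity or an exceptional divisor -/

theorem strictTransform₁_X_one_zero :
    strictTransform₁ (MvPowerSeries.X 1) ((0 : ℂ) : OnePoint ℂ) = MvPowerSeries.X 1 := by
  have ho : (MvPowerSeries.X 1 : Germ).order = 1 := by
    classical
    rw [MvPowerSeries.X_def, MvPowerSeries.order_monomial_of_ne_zero one_ne_zero]
    simp
  rw [strictTransform₁, totalTransform_X, ho, chart_coe]
  have := divExceptional_X_pow_mul 1 (MvPowerSeries.X 1)
  simpa using this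

theorem strictTransform₁_X_zero_infty :
    strictTransform₁ (MvPowerSeries.X 0) OnePoint.infty = MvPowerSeries.X 1 := by
  have ho : (MvPowerSeries.X 0 : Germ).order = 1 := by
    classical
    rw [MvPowerSeries.X_def, MvPowerSeries.order_monomial_of_ne_zero one_ne_zero]
    simp
  rw [strictTransform₁, totalTransform_X, ho, chart_infty]
  have := divExceptional_X_pow_mul 1 (MvPowerSeries.X 1)
  simpa using this

theorem germL_eq : germL = MvPowerSeries.X 1 := by
  simp [germL, germAtP]

/-- At points of kind `root` or `line` the axis `v = 0` is the strict transform of `L`. -/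
theorem strictTransform_germL {q : InfPoint}
    (h : (ofPath q).kind = .root ∨ (ofPath q).kind = .line) :
    strictTransform germL q = MvPowerSeries.X 1 := by
  induction q using List.reverseRecOn with
  | nil => exact germL_eq
  | append_singleton q t ih =>
    rw [ofPath_append_singleton] at h
    replace h := h.resolve_left (step_kind_ne_root _ _)
    rw [strictTransform_append_singleton]
    rcases (ofPath q).step_trichotomy t with ⟨rfl, h1⟩ | ⟨rfl, h1⟩ | h1
    · rw [step_zero h1] at h
      rw [ih (AxisKind.strict_eq_line_iff.mp h), strictTransform₁_X_one_zero]
    · rw [step_infty h1] at h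
      cases h
    · rw [step_of_ne h1.1 h1.2] at h
      cases h

theorem kind_ne_line_of_not_passesThrough {q : InfPoint} (h : ¬ PassesThrough germL q) :
    (ofPath q).kind ≠ .line := by
  intro hk
  apply h
  rw [PassesThrough, strictTransform_germL (Or.inr hk)]
  simp

/-- At points of kind `exc` the axis `v = 0` is the strict transform of an exceptional divisor
`E_{q₁}` that is not the last one. -/
theorem exists_strictTransform_X_zero {q : InfPoint} (h : (ofPath q).kind = .exc) :
    ∃ (q₁ : InfPoint) (t : OnePoint ℂ) (r : InfPoint), q = q₁ ++ t :: r ∧ r ≠ [] ∧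
      strictTransform (MvPowerSeries.X 0) r = MvPowerSeries.X 1 := by
  induction q using List.reverseRecOn with
  | nil => cases h
  | append_singleton q t ih =>
    rw [ofPath_append_singleton] at h
    rcases (ofPath q).step_trichotomy t with ⟨rfl, h1⟩ | ⟨rfl, h1⟩ | h1
    · rw [step_zero h1] at h
      obtain ⟨q₁, t, r, rfl, -, hr⟩ := ih (AxisKind.strict_eq_exc_iff.mp h)
      refine ⟨q₁, t, r ++ [((0 : ℂ) : OnePoint ℂ)], by simp, by simp, ?_⟩
      rw [strictTransform_append_singleton, hr, strictTransform₁_X_one_zero]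
    · rcases List.eq_nil_or_concat' q with rfl | ⟨q', t, rfl⟩
      · exact absurd rfl h1
      · exact ⟨q', t, [OnePoint.infty], by simp, by simp, strictTransform₁_X_zero_infty⟩
    · rw [step_of_ne h1.1 h1.2] at h
      cases h

/-- A point of kind `exc` is proximate to its predecessor and to the point whose exceptional
divisor is `v = 0`. -/
theorem kind_ne_exc_of_isFree {q : InfPoint} (h : IsFree q) : (ofPath q).kind ≠ .exc := by
  intro hk
  obtain ⟨q₁, t, r, hq, hr, hX⟩ := exists_strictTransform_X_zero hk
  rcases List.eq_nil_or_concat' q with rfl | ⟨q', t', hq'⟩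
  · cases hk
  apply h
  refine ⟨q₁, q', ?_, ⟨t, r, hq, ?_⟩, ⟨t', [], hq', ?_⟩⟩
  · rintro rfl
    rw [hq] at hq'
    have := congrArg List.length hq'
    simp at this
    exact hr this
  · rw [PassesThrough, hX]
    simp
  · simp [PassesThrough, strictTransform]

theorem kind_eq_free {q : InfPoint} (h0 : q ≠ []) (h1 : IsFree q)
    (h2 : (ofPath q).kind ≠ .line) : (ofPath q).kind = .free := by
  have h3 := kind_ne_exc_of_isFree h1
  have h4 : (ofPath q).kind ≠ .root := fun h => h0 (eq_nil_of_kind_eq_root h)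
  cases h : (ofPath q).kind <;> simp_all

/-! ### Noether's formula -/

/-- Effect of a blowup on the intersection multiplicities with the coordinate axes, for an
irreducible germ passing through the point of direction `t`. -/
theorem axisOrder_step (s : PathForm) {g : Germ} (hg : Irreducible g) {t : OnePoint ℂ}
    (hu : ¬ IsUnit (strictTransform₁ g t)) :
    axisOrder 1 (strictTransform₁ g t) = g.order ∧
    ((t = ((0 : ℂ) : OnePoint ℂ) ∧ s.kind ≠ .free ∧ axisOrder 1 g = g.order ∧
        axisOrder 0 g = g.order + axisOrder 0 (strictTransform₁ g t)) ∨
      (t = OnePoint.infty ∧ s.kind ≠ .root ∧ axisOrder 0 g = g.order ∧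
        axisOrder 1 g = g.order + axisOrder 0 (strictTransform₁ g t)) ∨
      ((s.kind ≠ .free → t ≠ ((0 : ℂ) : OnePoint ℂ) ∧ axisOrder 0 g = g.order) ∧
        (s.kind ≠ .root → t ≠ OnePoint.infty ∧ axisOrder 1 g = g.order))) := by
  refine ⟨axisOrder_one_strictTransform₁ hg t hu, ?_⟩
  rcases s.step_trichotomy t with ⟨rfl, h1⟩ | ⟨rfl, h1⟩ | h1
  · left
    exact ⟨rfl, h1, axisOrder_one_eq_order_of_ne_infty hg (OnePoint.coe_ne_infty _) hu,
      axisOrder_zero_eq_add hg.ne_zero⟩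
  · right; left
    exact ⟨rfl, h1, axisOrder_zero_eq_order_of_infty hg hu, axisOrder_one_eq_add hg.ne_zero⟩
  · right; right
    exact ⟨fun h => ⟨h1.1 h, axisOrder_zero_eq_order_of_ne_zero hg (h1.1 h) hu⟩,
      fun h => ⟨h1.2 h, axisOrder_one_eq_order_of_ne_infty hg (h1.2 h) hu⟩⟩

/-- An irreducible germ different from `L` has finite intersection multiplicities with the special
axes. -/
theorem axisOrder_ne_top {f : Germ} (hf : Irreducible f) (hf0 : axisOrder 0 f ≠ ⊤) {q : InfPoint}
    (hq : PassesThrough f q) :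
    ((ofPath q).kind ≠ .root → axisOrder 1 (strictTransform f q) ≠ ⊤) ∧
    ((ofPath q).kind ≠ .free → axisOrder 0 (strictTransform f q) ≠ ⊤) := by
  induction q using List.reverseRecOn with
  | nil => exact ⟨fun h => absurd rfl h, fun _ => hf0⟩
  | append_singleton q t ih =>
    have hq' := hq.of_append
    have hg := hq'.irreducible hf
    have hu := (passesThrough_iff _ _).mp hq
    obtain ⟨ih1, ih2⟩ := ih hq'
    rw [strictTransform_append_singleton] at hu ⊢
    rw [ofPath_append_singleton]
    obtain ⟨h1, h⟩ := axisOrder_step (ofPath q) hg hu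
    refine ⟨fun _ => ?_, ?_⟩
    · rw [h1, ← coe_toNat_order hg.ne_zero]
      exact ENat.natCast_ne_top _
    · rcases h with ⟨rfl, hk, -, h0⟩ | ⟨rfl, hk, -, h0⟩ | ⟨h0, h1⟩
      · intro _ htop
        exact ih2 hk (by rw [h0, htop, add_top])
      · intro _ htop
        exact ih1 hk (by rw [h0, htop, add_top])
      · rw [step_of_ne (fun h => (h0 h).1) (fun h => (h1 h).1)]
        exact fun h => absurd rfl h

theorem sum_range_take_append (q : InfPoint) (t : OnePoint ℂ) (F : InfPoint → ℤ) :
    ∑ i ∈ Finset.range (q ++ [t]).length, F ((q ++ [t]).take i) =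
      ∑ i ∈ Finset.range q.length, F (q.take i) + F q := by
  rw [List.length_append, List.length_singleton, Finset.sum_range_succ]
  congr 1
  · refine Finset.sum_congr rfl fun i hi => ?_
    rw [Finset.mem_range] at hi
    rw [List.take_append_of_le_length hi.le]
  · simp

/-- Noether's formula: what remains of `(φ_L, f)_p ^ 2` after subtracting the squares of the
multiplicities of `f` at the points before `q` is the value at `q` of the form of the path. -/
theorem axisOrder_sq_eq {f : Germ} (hf : Irreducible f) (hf0 : axisOrder 0 f ≠ ⊤) {q : InfPoint}
    (hq : PassesThrough f q) :
    ((axisOrder 0 f).toNat : ℤ) ^ 2 =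
      ∑ i ∈ Finset.range q.length, (mult (q.take i) f : ℤ) ^ 2 +
        (ofPath q).eval (axisOrder 1 (strictTransform f q)).toNat
          (axisOrder 0 (strictTransform f q)).toNat := by
  induction q using List.reverseRecOn with
  | nil => simp [ofPath_nil, eval, strictTransform]
  | append_singleton q t ih =>
    have hq' := hq.of_append
    have hg := hq'.irreducible hf
    have hu := (passesThrough_iff _ _).mp hq
    have hfin := axisOrder_ne_top hf hf0 hq'
    have hfin' := axisOrder_ne_top hf hf0 hq
    rw [sum_range_take_append q t fun p => (mult p f : ℤ) ^ 2, ih hq', add_assoc]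
    congr 1
    rw [ofPath_append_singleton, strictTransform_append_singleton] at *
    have hbc := b_c_eq_zero_of_free q
    have hab := eq_of_root q
    rw [mult]
    set g := strictTransform f q with hgdef
    obtain ⟨h1, h⟩ := axisOrder_step (ofPath q) hg hu
    rw [h1]
    obtain ⟨m, hm⟩ := ENat.ne_top_iff_exists.mp
      (by rw [← coe_toNat_order hg.ne_zero]; exact ENat.natCast_ne_top _ : g.order ≠ ⊤)
    rw [← hm] at h ⊢
    rcases h with ⟨rfl, hk, hx, hy⟩ | ⟨rfl, hk, hy, hx⟩ | ⟨hy, hx⟩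
    · have h2 := hfin'.2 (by rwa [step_zero hk, ne_eq, AxisKind.strict_eq_free_iff])
      obtain ⟨n, hn⟩ := ENat.ne_top_iff_exists.mp h2
      rw [step_zero hk, hx, hy, ← hn, ← ENat.natCast_add]
      simp only [ENat.toNat_natCast, eval]
      push_cast
      ring
    · have h2 := hfin'.2 (by rw [step_infty hk]; simp)
      obtain ⟨n, hn⟩ := ENat.ne_top_iff_exists.mp h2
      rw [step_infty hk, hx, hy, ← hn, ← ENat.natCast_add]
      simp only [ENat.toNat_natCast, eval]
      push_cast
      ring
    · rw [step_of_ne (fun h => (hy h).1) (fun h => (hx h).1)]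
      by_cases hk : (ofPath q).kind = .root
      · have hk' : (ofPath q).kind ≠ .free := by rw [hk]; simp
        rw [hab hk, (hy hk').2]
        simp [eval]
      · rw [(hx hk).2]
        by_cases hk' : (ofPath q).kind = .free
        · simp only [eval, hbc hk', ENat.toNat_natCast]
          ring
        · rw [(hy hk').2]
          simp only [eval, ENat.toNat_natCast]
          ring

theorem exists_order_eq {g : Germ} (hg : g ≠ 0) : ∃ m : ℕ, (m : ℕ∞) = g.order :=
  ⟨_, coe_toNat_order hg⟩

theorem one_le_order {g : Germ} (hg : Irreducible g) : 1 ≤ g.order := by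
  rw [Order.one_le_iff_ne_zero]
  rw [MvPowerSeries.order_ne_zero_iff_constCoeff_eq_zero]
  by_contra h
  exact hg.not_isUnit ((isUnit_iff_constantCoeff_ne_zero g).mpr h)

/-- The multiplicities of an irreducible germ before `q`, and its intersection with `L`, are
determined by its intersection multiplicities with the special axes at `q`. -/
theorem mult_eq_of_axisOrder_eq {f f' : Germ} (hf : Irreducible f) (hf' : Irreducible f')
    {q : InfPoint} (hq : PassesThrough f q) (hq' : PassesThrough f' q)
    (h1 : (ofPath q).kind ≠ .root →
      axisOrder 1 (strictTransform f q) = axisOrder 1 (strictTransform f' q))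
    (h0 : (ofPath q).kind ≠ .free →
      axisOrder 0 (strictTransform f q) = axisOrder 0 (strictTransform f' q)) :
    (∀ i < q.length, mult (q.take i) f = mult (q.take i) f') ∧ axisOrder 0 f = axisOrder 0 f' := by
  induction q using List.reverseRecOn with
  | nil => exact ⟨fun i hi => absurd hi (Nat.not_lt_zero i), h0 (by rw [ofPath_nil]; simp)⟩
  | append_singleton q t ih =>
    have hg := hq.of_append.irreducible hf
    have hg' := hq'.of_append.irreducible hf'
    have hu := (passesThrough_iff _ _).mp hq
    have hu' := (passesThrough_iff _ _).mp hq'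
    rw [strictTransform_append_singleton] at hu hu'
    simp only [strictTransform_append_singleton] at h1 h0
    rw [ofPath_append_singleton] at h1 h0
    have hx := (axisOrder_step (ofPath q) hg hu).1
    have hx' := (axisOrder_step (ofPath q) hg' hu').1
    have hord : (strictTransform f q).order = (strictTransform f' q).order := by
      rw [← hx, ← hx', h1 (step_kind_ne_root _ _)]
    have key := ih hq.of_append hq'.of_append ?_ ?_
    · refine ⟨fun i hi => ?_, key.2⟩
      rw [List.length_append, List.length_singleton, Nat.lt_succ_iff] at hi
      rw [List.take_append_of_le_length hi]
      rcases hi.lt_or_eq with hi | rfl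
      · exact key.1 i hi
      · rw [List.take_length, mult, mult, hord]
    · intro hk
      rcases (ofPath q).step_trichotomy t with ⟨rfl, h⟩ | ⟨rfl, h⟩ | h
      · rw [axisOrder_one_eq_order_of_ne_infty hg (OnePoint.coe_ne_infty _) hu,
          axisOrder_one_eq_order_of_ne_infty hg' (OnePoint.coe_ne_infty _) hu', hord]
      · rw [axisOrder_one_eq_add hg.ne_zero, axisOrder_one_eq_add hg'.ne_zero, hord,
          h0 (by rw [step_infty h]; simp)]
      · rw [axisOrder_one_eq_order_of_ne_infty hg (h.2 hk) hu,
          axisOrder_one_eq_order_of_ne_infty hg' (h.2 hk) hu', hord]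
    · intro hk
      rcases (ofPath q).step_trichotomy t with ⟨rfl, h⟩ | ⟨rfl, h⟩ | h
      · rw [axisOrder_zero_eq_add hg.ne_zero, axisOrder_zero_eq_add hg'.ne_zero, hord,
          h0 (by rwa [step_zero h, ne_eq, AxisKind.strict_eq_free_iff])]
      · rw [axisOrder_zero_eq_order_of_infty hg hu, axisOrder_zero_eq_order_of_infty hg' hu', hord]
      · rw [axisOrder_zero_eq_order_of_ne_zero hg (h.1 hk) hu,
          axisOrder_zero_eq_order_of_ne_zero hg' (h.1 hk) hu', hord]

/-! ### The pencil along the path of the curve -/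

theorem nat_le_order_X_pow_mul (U : Germ) (α β : ℕ) :
    ((α + β : ℕ) : ℕ∞) ≤ (U * MvPowerSeries.X 0 ^ α * MvPowerSeries.X 1 ^ β : Germ).order := by
  have h : ∀ (i : Fin 2) (n : ℕ), (n : ℕ∞) ≤ ((MvPowerSeries.X i : Germ) ^ n).order := by
    classical
    intro i n
    rw [MvPowerSeries.X_pow_eq, MvPowerSeries.order_monomial_of_ne_zero one_ne_zero]
    simp
  rw [MvPowerSeries.order_mul, MvPowerSeries.order_mul, ENat.natCast_add]
  exact add_le_add ((h 0 α).trans le_add_self) (h 1 β)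

theorem isUnit_X_pow_mul_iff {U : Germ} (hU : IsUnit U) (α β : ℕ) :
    IsUnit (U * MvPowerSeries.X 0 ^ α * MvPowerSeries.X 1 ^ β : Germ) ↔ α = 0 ∧ β = 0 := by
  rw [isUnit_iff_constantCoeff_ne_zero] at hU ⊢
  simp [hU]

/-- In the direction of `v = 0` the exponents `(α, β)` become `(α + β, β)`. -/
theorem totalTransform_X_pow_mul_zero (U : Germ) (α β : ℕ) :
    totalTransform ((0 : ℂ) : OnePoint ℂ) (U * MvPowerSeries.X 0 ^ α * MvPowerSeries.X 1 ^ β) =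
      MvPowerSeries.X 0 ^ (α + β) *
        (totalTransform ((0 : ℂ) : OnePoint ℂ) U * MvPowerSeries.X 1 ^ β) := by
  simp only [totalTransform_mul, totalTransform_pow, totalTransform_X, chart_coe]
  simp only [Matrix.cons_val_zero, Matrix.cons_val_one, map_zero, add_zero]
  ring

/-- In the direction of `u = 0` the exponents `(α, β)` become `(α + β, α)`. -/
theorem totalTransform_X_pow_mul_infty (U : Germ) (α β : ℕ) :
    totalTransform OnePoint.infty (U * MvPowerSeries.X 0 ^ α * MvPowerSeries.X 1 ^ β) =
      MvPowerSeries.X 0 ^ (α + β) *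
        (totalTransform OnePoint.infty U * MvPowerSeries.X 1 ^ α) := by
  simp only [totalTransform_mul, totalTransform_pow, totalTransform_X, chart_infty]
  simp only [Matrix.cons_val_zero, Matrix.cons_val_one]
  ring

/-- In a direction other than those of the axes contained in `u ^ α v ^ β = 0`, only the exceptional
divisor remains. -/
theorem exists_totalTransform_X_pow_mul {U : Germ} (hU : IsUnit U) {t : OnePoint ℂ} (α β : ℕ)
    (h0 : t = ((0 : ℂ) : OnePoint ℂ) → β = 0) (h1 : t = OnePoint.infty → α = 0) :
    ∃ U' : Germ, IsUnit U' ∧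
      totalTransform t (U * MvPowerSeries.X 0 ^ α * MvPowerSeries.X 1 ^ β) =
        MvPowerSeries.X 0 ^ (α + β) * U' := by
  by_cases ht0 : t = ((0 : ℂ) : OnePoint ℂ)
  · subst ht0
    refine ⟨_, isUnit_totalTransform (0 : ℂ) hU, ?_⟩
    rw [totalTransform_X_pow_mul_zero, h0 rfl, pow_zero, mul_one]
  by_cases ht1 : t = OnePoint.infty
  · subst ht1
    refine ⟨_, isUnit_totalTransform OnePoint.infty hU, ?_⟩
    rw [totalTransform_X_pow_mul_infty, h1 rfl, pow_zero, mul_one]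
  obtain ⟨c, rfl⟩ := OnePoint.ne_infty_iff_exists.mp ht1
  have hc : c ≠ 0 := fun h => ht0 (h ▸ rfl)
  refine ⟨totalTransform c U * (MvPowerSeries.X 1 + MvPowerSeries.C c) ^ β,
    (isUnit_totalTransform _ hU).mul (IsUnit.pow _ ?_), ?_⟩
  · rw [isUnit_iff_constantCoeff_ne_zero]
    simpa using hc
  · simp only [totalTransform_mul, totalTransform_pow, totalTransform_X, chart_coe]
    simp only [Matrix.cons_val_zero, Matrix.cons_val_one, mul_pow]
    ring

theorem pencilTransform₁_eq {f g : Germ} (h : f.order ≤ g.order) (t : OnePoint ℂ) :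
    pencilTransform₁ (f, g) t =
      (strictTransform₁ f t, divExceptional f.order.toNat (totalTransform t g)) := by
  simp only [pencilTransform₁, min_eq_left h, strictTransform₁]

theorem divExceptional_X_pow_mul_of_le {m n : ℕ} (h : m ≤ n) (g : Germ) :
    divExceptional m (MvPowerSeries.X 0 ^ n * g) = MvPowerSeries.X 0 ^ (n - m) * g := by
  obtain ⟨k, rfl⟩ := Nat.exists_eq_add_of_le h
  rw [pow_add, mul_assoc, divExceptional_X_pow_mul, Nat.add_sub_cancel_left]

/-- A monomial curve `u ^ α v ^ β = 0` whose intersection number with a germ is at least `x y`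
has multiplicity at least `min x y`. -/
theorem le_add_of_mul_le {m x y α β : ℕ} (hx : m ≤ x) (hy : m ≤ y) (hm : 1 ≤ m)
    (h : x * y ≤ α * x + β * y) : m ≤ α + β := by
  by_contra! hlt
  rcases le_total x y with hxy | hxy
  · have h1 : α * x + β * y ≤ (α + β) * y := by nlinarith
    nlinarith
  · have h1 : α * x + β * y ≤ (α + β) * x := by nlinarith
    nlinarith

/-- The pencil spanned by `f` and `v ^ d = 0`, at a point `q` of `f` before which there are only
base points. Its first generator is the strict transform of `f` and its second one is a unit times
`u ^ α v ^ β`. The intersection number `α x + β y` of the two is the value at `(x, y)` of the form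
of the path, whose coefficients satisfy the sign conditions, except that `a = 0` may occur at kind
`free`. -/
theorem exists_pencil_eq {f : Germ} (hf : Irreducible f) {d : ℕ} (hd : axisOrder 0 f = d)
    {q : InfPoint} (hq : PassesThrough f q)
    (hb : ∀ i < q.length, IsBasePoint f (MvPowerSeries.X 1 ^ d) (q.take i)) :
    ∃ (U : Germ) (α β : ℕ), IsUnit U ∧
      q.foldl pencilTransform₁ (f, MvPowerSeries.X 1 ^ d) =
        (strictTransform f q, U * MvPowerSeries.X 0 ^ α * MvPowerSeries.X 1 ^ β) ∧
      ((ofPath q).kind = .free → β = 0) ∧ ((ofPath q).kind = .root → α = 0 ∧ β = d) ∧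
      (α * (axisOrder 1 (strictTransform f q)).toNat +
        β * (axisOrder 0 (strictTransform f q)).toNat : ℤ) =
          (ofPath q).eval (axisOrder 1 (strictTransform f q)).toNat
            (axisOrder 0 (strictTransform f q)).toNat ∧
      ((ofPath q).Positive ∨ (ofPath q).kind = .free ∧ 0 ≤ (ofPath q).a) := by
  induction q using List.reverseRecOn with
  | nil =>
    refine ⟨1, 0, d, isUnit_one, by simp [strictTransform], fun h => (by cases h),
      fun _ => ⟨rfl, rfl⟩, ?_, Or.inl ?_⟩
    · simp only [strictTransform, List.foldl_nil, hd, ofPath_nil, eval, ENat.toNat_natCast]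
      push_cast
      ring
    · rw [ofPath_nil]
      exact ⟨rfl, rfl, rfl⟩
  | append_singleton q t ih =>
    have hq' := hq.of_append
    have hg := hq'.irreducible hf
    have hu := (passesThrough_iff _ _).mp hq
    have hd' : axisOrder 0 f ≠ ⊤ := by rw [hd]; exact ENat.natCast_ne_top _
    have hfin := axisOrder_ne_top hf hd' hq'
    have hfin' := axisOrder_ne_top hf hd' hq
    obtain ⟨U, α, β, hU, hfold, hfree, hroot, hN, hpos⟩ := ih hq' fun i hi => by
      have := hb i (by simp; omega)
      rwa [List.take_append_of_le_length hi.le] at this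
    have hbase : IsBasePoint f (MvPowerSeries.X 1 ^ d) q := by
      have := hb q.length (by simp)
      rwa [List.take_append_of_le_length le_rfl, List.take_length] at this
    have hαβ : ¬ (α = 0 ∧ β = 0) := by
      rw [← isUnit_X_pow_mul_iff hU, isUnit_iff_constantCoeff_ne_zero, not_not]
      have := hbase.2
      rwa [hfold] at this
    rw [strictTransform_append_singleton] at hu hfin' ⊢
    rw [ofPath_append_singleton] at hfin' ⊢
    rw [List.foldl_append, hfold, List.foldl_cons, List.foldl_nil]
    have hbc := b_c_eq_zero_of_free q
    have hab := eq_of_root q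
    set s := ofPath q with hs
    set g := strictTransform f q with hgdef
    obtain ⟨m, hm⟩ := exists_order_eq hg.ne_zero
    have hm1 : 1 ≤ m := by
      have := one_le_order hg
      rw [← hm] at this
      exact_mod_cast this
    have hmx : s.kind ≠ .root → m ≤ (axisOrder 1 g).toNat := fun h => by
      rw [← ENat.natCast_le_natCast, ENat.natCast_toNat (hfin.1 h), hm]
      exact order_le_axisOrder _ _
    have hmy : s.kind ≠ .free → m ≤ (axisOrder 0 g).toNat := fun h => by
      rw [← ENat.natCast_le_natCast, ENat.natCast_toNat (hfin.2 h), hm]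
      exact order_le_axisOrder _ _
    -- a point of kind `free` with `a = 0` has `α = 0`, and is not a base point
    have hPos : s.Positive := by
      rcases hpos with h | ⟨hk, ha⟩
      · exact h
      · have hβ := hfree hk
        have hx := hmx (by rw [hk]; simp)
        rw [hβ, eval, (hbc hk).1, (hbc hk).2] at hN
        have hα : 1 ≤ α := by omega
        have : s.a ≠ 0 := by
          intro h0
          rw [h0] at hN
          have : 0 < (α : ℤ) * (axisOrder 1 g).toNat := by
            exact mul_pos (by exact_mod_cast hα) (by exact_mod_cast (hm1.trans hx))
          simp only [Nat.cast_zero, zero_mul, add_zero] at hN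
          omega
        rw [Positive, hk]
        exact ⟨by omega, hbc hk⟩
    -- the member `v ^ d = 0` has at least the multiplicity of `f` at `q`, so the latter is the one
    -- removed from the pencil by the blowup
    have hle : m ≤ α + β := by
      set x := (axisOrder 1 g).toNat
      set y := (axisOrder 0 g).toNat
      rw [Positive] at hPos
      rw [eval] at hN
      rcases hk : s.kind with _ | _ | _ | _ <;> simp only [hk] at hPos
      · have hy := hmy (by rw [hk]; simp)
        obtain ⟨hα, hβ⟩ := hroot hk
        rw [hPos.1, hPos.2.1, hPos.2.2, hα] at hN
        have : (y : ℤ) * (β - y) = 0 := by linear_combination hN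
        rcases mul_eq_zero.mp this with h | h <;> omega
      · refine le_add_of_mul_le (hmx (by rw [hk]; simp)) (hmy (by rw [hk]; simp)) hm1 ?_
        zify
        rw [hN]
        nlinarith [mul_nonneg hPos.1 (sq_nonneg (x : ℤ)),
          mul_nonneg (show 0 ≤ s.b - 1 by omega) (show (0 : ℤ) ≤ x * y by positivity),
          mul_nonneg (show 0 ≤ s.c by omega) (sq_nonneg (y : ℤ))]
      · refine le_add_of_mul_le (hmx (by rw [hk]; simp)) (hmy (by rw [hk]; simp)) hm1 ?_
        zify
        rw [hN]
        nlinarith [mul_nonneg hPos.1 (sq_nonneg (x : ℤ)),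
          mul_nonneg (show 0 ≤ s.b - 1 by omega) (show (0 : ℤ) ≤ x * y by positivity),
          mul_nonneg (show 0 ≤ s.c by omega) (sq_nonneg (y : ℤ))]
      · have hx := hmx (by rw [hk]; simp)
        rw [hfree hk, hPos.2.1, hPos.2.2] at hN
        have h1 : (x : ℤ) * (α - s.a * x) = 0 := by
          simp only [Nat.cast_zero] at hN
          linear_combination hN
        rcases mul_eq_zero.mp h1 with h | h
        · omega
        · have h2 : (x : ℤ) ≤ α := by nlinarith
          omega
    have hord : g.order ≤ (U * MvPowerSeries.X 0 ^ α * MvPowerSeries.X 1 ^ β : Germ).order := by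
      rw [← hm]
      exact le_trans (by exact_mod_cast hle) (nat_le_order_X_pow_mul U α β)
    rw [pencilTransform₁_eq hord, ← hm, ENat.toNat_natCast]
    have hcast : ((α + β - m : ℕ) : ℤ) = α + β - m := by
      rw [Nat.cast_sub hle, Nat.cast_add]
    have hpos' : (s.step t).Positive ∨ (s.step t).kind = .free ∧ 0 ≤ (s.step t).a := hPos.step t
    obtain ⟨h1, h⟩ := axisOrder_step s hg hu
    rw [← hm] at h h1
    rw [h1]
    rcases h with ⟨rfl, hk, hx, hy⟩ | ⟨rfl, hk, hy, hx⟩ | ⟨hy, hx⟩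
    · have h2 := hfin'.2 (by rwa [step_zero hk, ne_eq, AxisKind.strict_eq_free_iff])
      obtain ⟨n, hn⟩ := ENat.ne_top_iff_exists.mp h2
      refine ⟨totalTransform (0 : ℂ) U, α + β - m, β, isUnit_totalTransform _ hU, ?_, ?_, ?_, ?_,
        hpos'⟩
      · rw [totalTransform_X_pow_mul_zero, divExceptional_X_pow_mul_of_le hle]
        congr 1
        ring
      · rw [step_zero hk]
        exact fun h => absurd (AxisKind.strict_eq_free_iff.mp h) hk
      · exact fun h => absurd h (step_kind_ne_root _ _)
      · rw [hx, hy, ← hn, ← ENat.natCast_add] at hN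
        rw [step_zero hk, ← hn, hcast]
        simp only [ENat.toNat_natCast, eval] at hN ⊢
        push_cast at hN
        linear_combination hN
    · have h2 := hfin'.2 (by rw [step_infty hk]; simp)
      obtain ⟨n, hn⟩ := ENat.ne_top_iff_exists.mp h2
      refine ⟨totalTransform OnePoint.infty U, α + β - m, α, isUnit_totalTransform _ hU, ?_, ?_, ?_,
        ?_, hpos'⟩
      · rw [totalTransform_X_pow_mul_infty, divExceptional_X_pow_mul_of_le hle]
        congr 1
        ring
      · rw [step_infty hk]
        exact fun h => by cases h
      · exact fun h => absurd h (step_kind_ne_root _ _)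
      · rw [hx, hy, ← hn, ← ENat.natCast_add] at hN
        rw [step_infty hk, ← hn, hcast]
        simp only [ENat.toNat_natCast, eval] at hN ⊢
        push_cast at hN
        linear_combination hN
    · obtain ⟨U', hU', htt⟩ := exists_totalTransform_X_pow_mul hU α β
        (fun h => hfree (by by_contra hk; exact (hy hk).1 h))
        (fun h => (hroot (by by_contra hk; exact (hx hk).1 h)).1)
      refine ⟨U', α + β - m, 0, hU', ?_, fun _ => rfl, ?_, ?_, hpos'⟩
      · rw [htt, divExceptional_X_pow_mul_of_le hle]
        congr 1
        ring
      · exact fun h => absurd h (step_kind_ne_root _ _)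
      · rw [step_of_ne (fun h => (hy h).1) (fun h => (hx h).1), hcast]
        simp only [eval, ENat.toNat_natCast] at hN ⊢
        by_cases hk : s.kind = .root
        · have hk' : s.kind ≠ .free := by rw [hk]; simp
          rw [(hy hk').2, hab hk, (hroot hk).1] at hN
          rw [hab hk, (hroot hk).1]
          simp only [ENat.toNat_natCast] at hN
          push_cast at hN ⊢
          linear_combination hN
        · rw [(hx hk).2] at hN
          by_cases hk' : s.kind = .free
          · rw [(hbc hk').1, (hbc hk').2, hfree hk'] at hN
            rw [(hbc hk').1, (hbc hk').2, hfree hk']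
            simp only [ENat.toNat_natCast] at hN
            push_cast at hN ⊢
            linear_combination hN
          · rw [(hy hk').2] at hN
            simp only [ENat.toNat_natCast] at hN
            push_cast at hN ⊢
            linear_combination hN

/-- At a base point on the curve, the terminal case (kind `free` with `a = 0`) does not occur. -/
theorem positive_of_isBasePoint {f : Germ} (hf : Irreducible f) {d : ℕ} (hd : axisOrder 0 f = d)
    {q : InfPoint} (hq : PassesThrough f q)
    (hb : ∀ i ≤ q.length, IsBasePoint f (MvPowerSeries.X 1 ^ d) (q.take i)) :
    (ofPath q).Positive := by
  obtain ⟨U, α, β, hU, hfold, hfree, -, hN, hpos⟩ :=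
    exists_pencil_eq hf hd hq fun i hi => hb i hi.le
  rcases hpos with h | ⟨hk, ha⟩
  · exact h
  · have hbase := (hb q.length le_rfl).2
    rw [List.take_length, hfold, ← not_ne_iff, ← isUnit_iff_constantCoeff_ne_zero,
      isUnit_X_pow_mul_iff hU] at hbase
    have hbc := b_c_eq_zero_of_free q hk
    rw [hfree hk, eval, hbc.1, hbc.2] at hN
    have hP : (ofPath q).Positive =
        (1 ≤ (ofPath q).a ∧ (ofPath q).b = 0 ∧ (ofPath q).c = 0) := by rw [Positive, hk]
    rw [hP]
    refine ⟨?_, hbc⟩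
    have hα : (1 : ℤ) ≤ α := by
      have := hfree hk
      omega
    have hx := (axisOrder_ne_top hf (by rw [hd]; exact ENat.natCast_ne_top _) hq).1
      (by rw [hk]; simp)
    have hx0 : (axisOrder 1 (strictTransform f q)).toNat ≠ 0 := by
      rw [ne_eq, ENat.toNat_eq_zero, not_or, axisOrder_eq_zero_iff]
      exact ⟨(passesThrough_iff _ _).mp hq, hx⟩
    by_contra! hlt
    have ha0 : (ofPath q).a = 0 := by omega
    rw [ha0] at hN
    simp only [Nat.cast_zero, zero_mul, add_zero, mul_eq_zero] at hN
    omega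

/-- The first point on the curve that is not a base point lies on no special curve other than the
last exceptional divisor, and its form vanishes: otherwise the form would be positive on the
curve, while `α = β = 0`. -/
theorem kind_eq_free_of_not_isBasePoint {f : Germ} (hf : Irreducible f) {d : ℕ}
    (hd : axisOrder 0 f = d) (hd1 : d ≠ 0) {q : InfPoint} (hq : PassesThrough f q)
    (hb : ∀ i < q.length, IsBasePoint f (MvPowerSeries.X 1 ^ d) (q.take i))
    (hnb : ¬ IsBasePoint f (MvPowerSeries.X 1 ^ d) q) :
    (ofPath q).kind = .free ∧ (ofPath q).a = 0 := by
  obtain ⟨U, α, β, hU, hfold, hfree, hroot, hN, hpos⟩ := exists_pencil_eq hf hd hq hb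
  have hfin := axisOrder_ne_top hf (by rw [hd]; exact ENat.natCast_ne_top _) hq
  have hu := (passesThrough_iff _ _).mp hq
  have hαβ : α = 0 ∧ β = 0 := by
    rw [← isUnit_X_pow_mul_iff hU, isUnit_iff_constantCoeff_ne_zero]
    intro h
    apply hnb
    rw [IsBasePoint, hfold]
    exact ⟨hq, h⟩
  rw [hαβ.1, hαβ.2] at hN
  have hx0 : (ofPath q).kind ≠ .root → (axisOrder 1 (strictTransform f q)).toNat ≠ 0 := fun h => by
    rw [ne_eq, ENat.toNat_eq_zero, not_or, axisOrder_eq_zero_iff]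
    exact ⟨hu, hfin.1 h⟩
  have hy0 : (ofPath q).kind ≠ .free → (axisOrder 0 (strictTransform f q)).toNat ≠ 0 := fun h => by
    rw [ne_eq, ENat.toNat_eq_zero, not_or, axisOrder_eq_zero_iff]
    exact ⟨hu, hfin.2 h⟩
  set x := (axisOrder 1 (strictTransform f q)).toNat
  set y := (axisOrder 0 (strictTransform f q)).toNat
  have hkey : 0 ≤ (ofPath q).a → 1 ≤ (ofPath q).b → 0 ≤ (ofPath q).c →
      (ofPath q).kind ≠ .root → (ofPath q).kind ≠ .free → False := by
    intro ha hb hc h1 h2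
    have hx : (1 : ℤ) ≤ x := by have := hx0 h1; omega
    have hy : (1 : ℤ) ≤ y := by have := hy0 h2; omega
    rw [eval] at hN
    simp only [Nat.cast_zero, zero_mul, add_zero] at hN
    nlinarith [mul_nonneg ha (sq_nonneg (x : ℤ)), mul_nonneg hc (sq_nonneg (y : ℤ)),
      mul_pos (show 0 < (ofPath q).b by omega) (show (0 : ℤ) < x * y by positivity)]
  rcases hpos with h | ⟨hk, -⟩
  · rw [Positive] at h
    rcases hk : (ofPath q).kind with _ | _ | _ | _ <;> simp only [hk] at h
    · exact absurd ((hroot hk).2.symm.trans hαβ.2) hd1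
    · exact (hkey h.1 h.2.1 (by omega) (by simp [hk]) (by simp [hk])).elim
    · exact (hkey h.1 h.2.1 h.2.2 (by simp [hk]) (by simp [hk])).elim
    · have hx := hx0 (by simp [hk])
      rw [eval, h.2.1, h.2.2] at hN
      simp at hN
      omega
  · refine ⟨hk, ?_⟩
    have hx := hx0 (by simp [hk])
    have hbc := b_c_eq_zero_of_free q hk
    rw [eval, hbc.1, hbc.2] at hN
    simp at hN
    omega

/-- The predecessors of a base point are base points. -/
theorem IsBasePoint.of_append {f g : Germ} {q r : InfPoint} (h : IsBasePoint f g (q ++ r)) :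
    IsBasePoint f g q := by
  induction r using List.reverseRecOn with
  | nil => simpa using h
  | append_singleton r t ih =>
    apply ih
    rw [← List.append_assoc, IsBasePoint, List.foldl_append, List.foldl_cons, List.foldl_nil] at h
    rw [IsBasePoint]
    generalize List.foldl pencilTransform₁ (f, g) (q ++ r) = P at h ⊢
    obtain ⟨f', g'⟩ := P
    have key : ∀ k : Germ, min f'.order g'.order = 0 →
        divExceptional (min f'.order g'.order).toNat (totalTransform t k) = totalTransform t k := by
      intro k hk
      have := divExceptional_X_pow_mul 0 (totalTransform t k)
      rwa [pow_zero, one_mul, ← ENat.toNat_zero, ← hk] at this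
    have h0 : ∀ k : Germ, MvPowerSeries.constantCoeff k ≠ 0 → k.order = 0 := fun k hk =>
      order_eq_zero_of_isUnit ((isUnit_iff_constantCoeff_ne_zero k).mpr hk)
    constructor
    · by_contra hne
      have hmin : min f'.order g'.order = 0 := by rw [h0 _ hne]; simp
      have h1 := h.1
      simp only [pencilTransform₁, key _ hmin, constantCoeff_totalTransform] at h1
      exact hne h1
    · by_contra hne
      have hmin : min f'.order g'.order = 0 := by rw [h0 _ hne]; simp
      have h1 := h.2
      simp only [pencilTransform₁, key _ hmin, constantCoeff_totalTransform] at h1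
      exact hne h1

/-! ### Curvettes -/

/-- A germ that contains `L` follows it, so it passes only through points of kind `root` or
`line`. -/
theorem axisOrder_zero_ne_top_of_kind_eq_free {f : Germ} (hf : Irreducible f) {q : InfPoint}
    (hq : PassesThrough f q) (hk : (ofPath q).kind = .free) : axisOrder 0 f ≠ ⊤ := by
  intro htop
  have key : ((ofPath q).kind = .root ∨ (ofPath q).kind = .line) ∧
      axisOrder 0 (strictTransform f q) = ⊤ := by
    clear hk
    induction q using List.reverseRecOn with
    | nil => exact ⟨Or.inl rfl, htop⟩
    | append_singleton q t ih =>
      obtain ⟨ih1, ih2⟩ := ih hq.of_append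
      have hg := hq.of_append.irreducible hf
      have hu := (passesThrough_iff _ _).mp hq
      rw [strictTransform_append_singleton] at hu ⊢
      rw [ofPath_append_singleton]
      obtain ⟨m, hm⟩ := exists_order_eq hg.ne_zero
      have ht : t = ((0 : ℂ) : OnePoint ℂ) := by
        by_contra ht
        have := axisOrder_zero_eq_order_of_ne_zero hg ht hu
        rw [ih2, ← hm] at this
        exact ENat.natCast_ne_top _ this.symm
      subst ht
      have hk : (ofPath q).kind ≠ .free := by
        rcases ih1 with h | h <;> rw [h] <;> simp
      refine ⟨Or.inr ?_, ?_⟩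
      · rw [step_zero hk]
        exact AxisKind.strict_eq_line_iff.mpr ih1
      · have := axisOrder_zero_eq_add hg.ne_zero
        rw [ih2, ← hm] at this
        rcases WithTop.add_eq_top.mp this.symm with h | h
        · exact absurd h (ENat.natCast_ne_top _)
        · exact h
  rw [hk] at key
  simp at key

/-- A curvette of `q` leaves `E_q` transversally at a point of kind `free`. -/
theorem IsCurvette.exists_direction {q : InfPoint} {φ : Germ} (h : IsCurvette q φ) :
    ∃ t : OnePoint ℂ, PassesThrough φ (q ++ [t]) ∧ (ofPath (q ++ [t])).kind = .free ∧
      axisOrder 1 (strictTransform φ (q ++ [t])) = 1 := by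
  obtain ⟨-, t, hfree, hL, hpass, hcoeff⟩ := h
  refine ⟨t, hpass, kind_eq_free (by simp) hfree (kind_ne_line_of_not_passesThrough hL), ?_⟩
  rw [axisOrder]
  refine le_antisymm (PowerSeries.order_le 1 (by rwa [coeff_restr])) ?_
  rw [PowerSeries.one_le_order_iff_constCoeff_eq_zero, constantCoeff_restr]
  exact hpass

/-- At a general point of the last exceptional divisor, the germ is not tangent to the special
curves through the previous point. -/
theorem axisOrder_of_kind_eq_free {f : Germ} (hf : Irreducible f) {q : InfPoint} {t : OnePoint ℂ}
    (hq : PassesThrough f (q ++ [t])) (hk : (ofPath (q ++ [t])).kind = .free) :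
    axisOrder 1 (strictTransform f (q ++ [t])) = (strictTransform f q).order ∧
    ((ofPath q).kind ≠ .root →
      axisOrder 1 (strictTransform f q) = (strictTransform f q).order) ∧
    ((ofPath q).kind ≠ .free →
      axisOrder 0 (strictTransform f q) = (strictTransform f q).order) := by
  have hg := hq.of_append.irreducible hf
  have hu := (passesThrough_iff _ _).mp hq
  rw [strictTransform_append_singleton] at hu ⊢
  rw [ofPath_append_singleton] at hk
  obtain ⟨h0, h1⟩ := ne_of_step_kind_eq_free hk
  exact ⟨axisOrder_one_strictTransform₁ hg t hu,
    fun h => axisOrder_one_eq_order_of_ne_infty hg (h1 h) hu,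
    fun h => axisOrder_zero_eq_order_of_ne_zero hg (h0 h) hu⟩

/-- A germ transversal to the exceptional divisor is smooth at the point blown up. -/
theorem mult_eq_one {f : Germ} (hf : Irreducible f) {q : InfPoint} {t : OnePoint ℂ}
    (hq : PassesThrough f (q ++ [t]))
    (h1 : axisOrder 1 (strictTransform f (q ++ [t])) = 1) : mult q f = 1 := by
  have hg := hq.of_append.irreducible hf
  have hu := (passesThrough_iff _ _).mp hq
  rw [strictTransform_append_singleton] at hu h1
  rw [mult, ← axisOrder_one_strictTransform₁ hg t hu, h1]
  rfl

/-- Along a chain of points of kind `free`, a germ transversal to the last exceptional divisor is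
transversal to all of them. -/
theorem axisOrder_one_eq_one_of_prefix {f : Germ} (hf : Irreducible f) {q r : InfPoint}
    (hq : PassesThrough f (q ++ r)) (hk : ∀ r', r' <+: r → (ofPath (q ++ r')).kind = .free)
    (h1 : axisOrder 1 (strictTransform f (q ++ r)) = 1) :
    ∀ r', r' <+: r → axisOrder 1 (strictTransform f (q ++ r')) = 1 := by
  induction r using List.reverseRecOn with
  | nil =>
    intro r' hr'
    rw [List.prefix_nil.mp hr']
    exact h1
  | append_singleton r t ih =>
    intro r' hr'
    rcases List.prefix_concat_iff.mp hr' with rfl | hr'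
    · exact h1
    · rw [← List.append_assoc] at hq h1
      obtain ⟨h2, h3, -⟩ := axisOrder_of_kind_eq_free hf hq
        (by rw [List.append_assoc]; exact hk _ (List.prefix_refl _))
      refine ih hq.of_append (fun r'' h => hk r'' (h.trans (List.prefix_append _ _))) ?_ r' hr'
      rw [h3 (by rw [hk r (List.prefix_append _ _)]; simp), ← h2, h1]

/-- The self-intersection of the class of a curvette, read off from the form of its path. -/
theorem IsCurvette.sq_sub_sum {q : InfPoint} {φ : Germ} (h : IsCurvette q φ) {t : OnePoint ℂ}
    (hq : PassesThrough φ (q ++ [t])) (hk : (ofPath (q ++ [t])).kind = .free)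
    (h1 : axisOrder 1 (strictTransform φ (q ++ [t])) = 1) :
    ((axisOrder 0 φ).toNat : ℤ) ^ 2 -
      ∑ i ∈ Finset.range (q.length + 1), (mult (q.take i) φ : ℤ) ^ 2 =
        (ofPath (q ++ [t])).a := by
  have := axisOrder_sq_eq h.1 (axisOrder_zero_ne_top_of_kind_eq_free h.1 hq hk) hq
  have hbc := b_c_eq_zero_of_free _ hk
  rw [this, h1, sum_range_take_append q t fun p => (mult p φ : ℤ) ^ 2, eval, hbc.1, hbc.2,
    Finset.sum_range_succ, List.take_length]
  simp

/-! ### Intersection multiplicity with the line at infinity -/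

theorem restr_surjective (i : Fin 2) (w : PowerSeries ℂ) : ∃ f : Germ, restr i f = w :=
  ⟨w.toMvPowerSeries i, MvPowerSeries.killCompl_rename_app
    (e := Function.Embedding.punit i) w⟩

/-- The quotient by `v` and `f` is the quotient of `ℂ⟦u⟧` by the restriction of `f`, of which the
monomials `1, u, …, u ^ (b - 1)` are a basis, `b` being the order. -/
theorem interMult_X_one {f : Germ} (hf : axisOrder 0 f ≠ ⊤) :
    interMult (MvPowerSeries.X 1) f = (axisOrder 0 f).toNat := by
  set b := (axisOrder 0 f).toNat with hb
  have hne : restr 0 f ≠ 0 := fun h => hf (by rw [axisOrder, h, PowerSeries.order_zero])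
  let T : Germ →ₗ[ℂ] (Fin b → ℂ) :=
    LinearMap.pi fun i => (PowerSeries.coeff (R := ℂ) i).comp (restr 0).toLinearMap
  have hT : ∀ g i, T g i = PowerSeries.coeff i.1 (restr 0 g) := fun g i => rfl
  have hsurj : Function.Surjective T := by
    intro c
    obtain ⟨g, hg⟩ := restr_surjective 0
      (PowerSeries.mk fun n => if h : n < b then c ⟨n, h⟩ else 0)
    refine ⟨g, funext fun i => ?_⟩
    rw [hT, hg, PowerSeries.coeff_mk, dif_pos i.2]
  have hker : LinearMap.ker T =
      (Ideal.span {MvPowerSeries.X 1, f} : Ideal Germ).restrictScalars ℂ := by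
    ext g
    rw [LinearMap.mem_ker, Submodule.restrictScalars_mem, Ideal.mem_span_pair]
    constructor
    · intro hg
      have hdvd : PowerSeries.X ^ b ∣ restr 0 g := by
        rw [PowerSeries.X_pow_dvd_iff]
        intro i hi
        exact congrFun hg ⟨i, hi⟩
      obtain ⟨w, hw⟩ := hdvd
      have hfu : restr 0 f = PowerSeries.X ^ b * PowerSeries.divXPowOrder (restr 0 f) :=
        PowerSeries.X_pow_order_mul_divXPowOrder.symm
      have hunit : IsUnit (PowerSeries.divXPowOrder (restr 0 f)) := by
        rw [PowerSeries.isUnit_iff_constantCoeff, isUnit_iff_ne_zero, ne_eq,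
          PowerSeries.constantCoeff_divXPowOrder_eq_zero_iff]
        exact hne
      obtain ⟨v, hv⟩ := hunit.exists_right_inv
      obtain ⟨k, hk⟩ := restr_surjective 0 (v * w)
      have hdvd : MvPowerSeries.X 1 ∣ g - k * f := by
        rw [← axisOrder_eq_top_iff 0 1 (by decide), axisOrder, PowerSeries.order_eq_top, map_sub,
          map_mul, hk, hfu, hw]
        linear_combination (-(PowerSeries.X ^ b * w)) * hv
      obtain ⟨e, he⟩ := hdvd
      exact ⟨e, k, by linear_combination -he⟩
    · rintro ⟨e, k, rfl⟩
      funext i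
      rw [hT, map_add, map_mul, map_mul, restr_X_of_ne (by decide), mul_zero, zero_add,
        Pi.zero_apply]
      apply PowerSeries.coeff_of_lt_order
      rw [PowerSeries.order_mul]
      refine lt_of_lt_of_le ?_ le_add_self
      rw [← PowerSeries.coe_toNat_order hne]
      exact_mod_cast i.2
  have e : (Germ ⧸ Ideal.span {MvPowerSeries.X 1, f}) ≃ₗ[ℂ] (Fin b → ℂ) :=
    (Submodule.Quotient.restrictScalarsEquiv ℂ _).symm.trans
      ((Submodule.quotEquivOfEq _ _ hker.symm).trans (T.quotKerEquivOfSurjective hsurj))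
  rw [interMult, e.finrank_eq, Module.finrank_fin_fun]

/-! ### The curve and its germ at `p` -/

theorem eval_smul_of_isHomogeneous {F : MvPolynomial (Fin 3) ℂ} {d : ℕ} (hF : F.IsHomogeneous d)
    (r : ℂ) (x : Fin 3 → ℂ) :
    MvPolynomial.eval (fun i => r * x i) F = r ^ d * MvPolynomial.eval x F := by
  rw [MvPolynomial.eval_eq', MvPolynomial.eval_eq', Finset.mul_sum]
  refine Finset.sum_congr rfl fun e he => ?_
  have hdeg : ∑ i, e i = d := by
    have := hF (MvPolynomial.mem_support_iff.mp he)
    rwa [show Finsupp.weight 1 e = e.degree from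
      (DFunLike.congr_fun (Finsupp.degree_eq_weight_one (R := ℕ)) e).symm,
      Finsupp.degree_eq_sum] at this
  simp only [mul_pow, Finset.prod_mul_distrib, Finset.prod_pow_eq_pow_sum, hdeg]
  ring

namespace CurveOnePlace

variable (C : CurveOnePlace)

/-- If the degree were zero, the equation would take the same value at the point `p` of `C ∩ L`
and at a point of `L` off `C`. -/
theorem d_ne_zero : C.d ≠ 0 := by
  intro hd
  have h := C.homogeneous
  rw [hd] at h
  have h1 := eval_smul_of_isHomogeneous h 0 ![1, 0, 0]
  have h2 := eval_smul_of_isHomogeneous h 0 ![0, 1, 0]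
  simp only [zero_mul, pow_zero, one_mul] at h1 h2
  have h3 := (C.inter_L 1 0 (by simp)).mpr rfl
  have h4 := (C.inter_L 0 1 (by simp)).mp (h2.symm.trans (h1.trans h3))
  exact one_ne_zero h4

/-- On the line at infinity the equation of the curve is a multiple of `𝒴 ^ d`. -/
theorem exists_eval_eq : ∃ c : ℂ, c ≠ 0 ∧
    MvPolynomial.aeval ![1, Polynomial.X, 0] C.F = Polynomial.C c * Polynomial.X ^ C.d := by
  have hev : ∀ (x : ℂ) (w : Fin 3 → Polynomial ℂ),
      Polynomial.eval x (MvPolynomial.aeval w C.F) =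
        MvPolynomial.eval (fun i => (w i).eval x) C.F := by
    intro x w
    induction C.F using MvPolynomial.induction_on with
    | C a => simp
    | add f g hf hg => rw [map_add, map_add, Polynomial.eval_add, hf, hg]
    | mul_X f i hf => rw [map_mul, map_mul, Polynomial.eval_mul, hf, MvPolynomial.aeval_X,
        MvPolynomial.eval_X]
  -- `F (x, 1, 0)` has no zero, so it is a constant `c`, and `F (1, y, 0) = y ^ d F (1 / y, 1, 0)`
  set Q : Polynomial ℂ := MvPolynomial.aeval ![Polynomial.X, 1, 0] C.F with hQ
  have hQ0 : ∀ x, Q.eval x ≠ 0 := by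
    intro x h
    rw [hQ, hev] at h
    have hw : (fun i => ((![Polynomial.X, 1, 0] : Fin 3 → Polynomial ℂ) i).eval x) =
        ![x, 1, 0] := by
      ext i
      fin_cases i <;> simp
    rw [hw] at h
    exact one_ne_zero ((C.inter_L x 1 (by simp)).mp h)
  have hQdeg : Q.degree = 0 := by
    by_contra h
    obtain ⟨x, hx⟩ := IsAlgClosed.exists_root Q h
    exact hQ0 x hx
  obtain hQc := Polynomial.eq_C_of_degree_eq_zero hQdeg
  set c := Q.coeff 0
  refine ⟨c, fun h => hQ0 0 (by rw [hQc, h]; simp), ?_⟩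
  refine Polynomial.funext fun y => ?_
  have hw : (fun i => ((![1, Polynomial.X, 0] : Fin 3 → Polynomial ℂ) i).eval y) = ![1, y, 0] := by
    ext i
    fin_cases i <;> simp
  rw [hev, hw]
  rcases eq_or_ne y 0 with rfl | hy
  · rw [(C.inter_L 1 0 (by simp)).mpr rfl]
    simp [C.d_ne_zero]
  · have h1 := eval_smul_of_isHomogeneous C.homogeneous y ![y⁻¹, 1, 0]
    have hw1 : (fun i => y * (![y⁻¹, 1, 0] : Fin 3 → ℂ) i) = ![1, y, 0] := by
      ext i
      fin_cases i <;> simp [hy]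
    have hw2 : (fun i => ((![Polynomial.X, 1, 0] : Fin 3 → Polynomial ℂ) i).eval y⁻¹) =
        ![y⁻¹, 1, 0] := by
      ext i
      fin_cases i <;> simp
    have h2 : Q.eval y⁻¹ = c := by rw [hQc]; simp
    rw [hQ, hev, hw2] at h2
    rw [hw1, h2] at h1
    rw [h1, Polynomial.eval_mul, Polynomial.eval_C, Polynomial.eval_pow, Polynomial.eval_X,
      mul_comm]

/-- The restriction of the germ to the line at infinity is the dehomogenized equation on that
line. -/
theorem restr_zero_germAtP (G : MvPolynomial (Fin 3) ℂ) : restr 0 (germAtP G) =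
    ((MvPolynomial.aeval ![1, Polynomial.X, 0] G : Polynomial ℂ) : PowerSeries ℂ) := by
  have h : (restr 0).comp (MvPolynomial.aeval ![1, MvPowerSeries.X 0, MvPowerSeries.X 1]) =
      (Polynomial.coeToPowerSeries.algHom ℂ).comp
        (MvPolynomial.aeval ![1, Polynomial.X, 0]) := by
    apply MvPolynomial.algHom_ext
    intro i
    rw [AlgHom.comp_apply, AlgHom.comp_apply, MvPolynomial.aeval_X, MvPolynomial.aeval_X,
      Polynomial.coeToPowerSeries.algHom_apply]
    fin_cases i
    · simp
    · simp [restr_X_self]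
    · simp [restr_X_of_ne]
  have := AlgHom.congr_fun h G
  rw [AlgHom.comp_apply, AlgHom.comp_apply, Polynomial.coeToPowerSeries.algHom_apply] at this
  simpa [germAtP] using this

/-- The curve meets the line at infinity at `p` with multiplicity `d`. -/
theorem axisOrder_zero_germAtP : axisOrder 0 (germAtP C.F) = C.d := by
  obtain ⟨c, hc, h⟩ := C.exists_eval_eq
  rw [axisOrder, restr_zero_germAtP, h, Polynomial.coe_mul, Polynomial.coe_C, Polynomial.coe_pow,
    Polynomial.coe_X, PowerSeries.order_mul, PowerSeries.order_X_pow,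
    PowerSeries.order_zero_of_unit, zero_add]
  rw [PowerSeries.isUnit_iff_constantCoeff]
  simpa using hc

theorem germAtP_X_pow (d : ℕ) :
    germAtP (MvPolynomial.X 2 ^ d) = (MvPowerSeries.X 1 : Germ) ^ d := by
  simp [germAtP]

theorem isBasePoint_iff (q : InfPoint) :
    C.IsBasePoint q ↔ PencilAtInfinity.IsBasePoint (germAtP C.F) (MvPowerSeries.X 1 ^ C.d) q := by
  rw [CurveOnePlace.IsBasePoint, germAtP_X_pow]

theorem isBasePoint_nil : C.IsBasePoint [] := by
  rw [CurveOnePlace.isBasePoint_iff, PencilAtInfinity.IsBasePoint]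
  refine ⟨?_, ?_⟩
  · have := C.unibranch.not_isUnit
    rwa [isUnit_iff_constantCoeff_ne_zero, not_not] at this
  · simp [C.d_ne_zero]

theorem germAtP_member (a b : ℂ) : germAtP (C.member a b) =
    MvPowerSeries.C a * germAtP C.F + MvPowerSeries.C b * MvPowerSeries.X 1 ^ C.d := by
  simp [germAtP, CurveOnePlace.member, MvPowerSeries.algebraMap_apply]

/-- If the curve has multiplicity `d` at `p`, then so has every member of the pencil other
than `d L`, and it is not tangent to `L`. -/
theorem not_passesThrough_member {a b : ℂ} (ha : a ≠ 0) (h : (germAtP C.F).order = C.d) :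
    ¬ PassesThrough (germAtP (C.member a b)) [((0 : ℂ) : OnePoint ℂ)] := by
  intro hp
  set g := germAtP (C.member a b) with hg
  have h0 : axisOrder 0 g = C.d := by
    rw [← C.axisOrder_zero_germAtP, axisOrder, axisOrder, hg, germAtP_member, map_add, map_mul,
      map_mul, map_pow, restr_X_of_ne (by decide), zero_pow C.d_ne_zero, mul_zero, add_zero,
      restr_C, PowerSeries.order_mul, PowerSeries.order_zero_of_unit, zero_add]
    rw [PowerSeries.isUnit_iff_constantCoeff]
    simpa using ha
  have hg0 : g ≠ 0 := by
    intro h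
    rw [h, axisOrder, map_zero, PowerSeries.order_zero] at h0
    exact ENat.natCast_ne_top _ h0.symm
  have hord : (C.d : ℕ∞) ≤ g.order := by
    rw [hg, germAtP_member]
    refine le_trans (le_min ?_ ?_) MvPowerSeries.min_order_le_add
    · rw [MvPowerSeries.order_mul, h]
      exact le_add_self
    · have := nat_le_order_X_pow_mul (MvPowerSeries.C b) 0 C.d
      simpa using this
  have h1 := axisOrder_zero_eq_add hg0
  have h2 : axisOrder 0 (strictTransform₁ g (0 : ℂ)) ≠ 0 := by
    rw [ne_eq, axisOrder_eq_zero_iff]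
    exact (passesThrough_iff _ _).mp hp
  rw [h0] at h1
  apply h2
  obtain ⟨m, hm⟩ := exists_order_eq hg0
  rw [← hm] at h1 hord
  have hle : m ≤ C.d := by
    have : (m : ℕ∞) ≤ C.d := h1 ▸ le_self_add
    exact_mod_cast this
  have heq : C.d = m := le_antisymm (by exact_mod_cast hord) hle
  rw [heq] at h1
  exact (ENat.add_right_injective_of_ne_top (ENat.natCast_ne_top m) (by simpa using h1)).symm

end CurveOnePlace

/-! ### The configuration of base points -/

namespace BaseConfiguration

variable {C : CurveOnePlace} (B : BaseConfiguration C)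

theorem length_p (i : ℕ) : (B.p (i + 1)).length = i := by
  induction i with
  | zero => rw [zero_add, B.p_one]; rfl
  | succ i ih =>
    obtain ⟨t, ht⟩ := B.p_succ (i + 1) (by omega)
    rw [ht, List.length_append, ih, List.length_singleton]

theorem take_p {i j : ℕ} (h : i ≤ j) : (B.p (j + 1)).take i = B.p (i + 1) := by
  induction j, h using Nat.le_induction with
  | base =>
    rw [List.take_of_length_le]
    rw [B.length_p]
  | succ j hj ih =>
    obtain ⟨t, ht⟩ := B.p_succ (j + 1) (by omega)
    rw [ht, List.take_append_of_le_length (by rw [B.length_p]; exact hj), ih]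

theorem one_le_n : 1 ≤ B.n := by
  obtain ⟨i, h1, h2, -⟩ := B.n_least.1 [] C.isBasePoint_nil
  omega

/-- Otherwise `n - 1` blowups would be sufficient. -/
theorem isBasePoint_p_n : C.IsBasePoint (B.p B.n) := by
  by_contra h
  have hmem : B.n - 1 ∈ {N : ℕ | ∀ q, C.IsBasePoint q → ∃ i, 1 ≤ i ∧ i ≤ N ∧ q = B.p i} := by
    intro q hq
    obtain ⟨i, h1, h2, rfl⟩ := B.n_least.1 q hq
    refine ⟨i, h1, ?_, rfl⟩
    rcases h2.lt_or_eq with h3 | rfl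
    · omega
    · exact absurd hq h
  have := B.n_least.2 hmem
  have := B.one_le_n
  omega

theorem isBasePoint_p {i : ℕ} (hi : i < B.n) : C.IsBasePoint (B.p (i + 1)) := by
  obtain ⟨n, hn⟩ := Nat.exists_eq_add_of_le' B.one_le_n
  have h := B.isBasePoint_p_n
  rw [CurveOnePlace.isBasePoint_iff, hn, ← List.take_append_drop i (B.p (n + 1)),
    B.take_p (by omega)] at h
  exact (C.isBasePoint_iff _).mpr h.of_append

theorem not_isBasePoint_p : ¬ C.IsBasePoint (B.p (B.n + 1)) := by
  intro h
  obtain ⟨i, h1, h2, h3⟩ := B.n_least.1 _ h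
  obtain ⟨i, rfl⟩ := Nat.exists_eq_add_of_le' h1
  have := congrArg List.length h3
  rw [B.length_p, B.length_p] at this
  omega

theorem isBasePoint_take {i j : ℕ} (hi : i < B.n) (hij : i ≤ j) :
    PencilAtInfinity.IsBasePoint (germAtP C.F) (MvPowerSeries.X 1 ^ C.d)
      ((B.p (j + 1)).take i) := by
  rw [B.take_p hij, ← CurveOnePlace.isBasePoint_iff]
  exact B.isBasePoint_p hi

theorem positive_ofPath_p {i : ℕ} (hi : i < B.n) : (ofPath (B.p (i + 1))).Positive := by
  refine positive_of_isBasePoint C.unibranch C.axisOrder_zero_germAtP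
    (B.p_mem _ (by omega)) fun k hk => ?_
  rw [B.length_p] at hk
  exact B.isBasePoint_take (by omega) hk

theorem ofPath_p_succ_n :
    (ofPath (B.p (B.n + 1))).kind = .free ∧ (ofPath (B.p (B.n + 1))).a = 0 := by
  refine kind_eq_free_of_not_isBasePoint C.unibranch C.axisOrder_zero_germAtP C.d_ne_zero
    (B.p_mem _ (by omega)) (fun k hk => ?_) ?_
  · rw [B.length_p] at hk
    exact B.isBasePoint_take hk hk.le
  · rw [← CurveOnePlace.isBasePoint_iff]
    exact B.not_isBasePoint_p

/-- The number `a + b + c - 1` is the coefficient `a` at `p_{n + 1}`, which vanishes. -/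
theorem sum_ofPath_p_n :
    (ofPath (B.p B.n)).a + (ofPath (B.p B.n)).b + (ofPath (B.p B.n)).c = 1 := by
  obtain ⟨t, ht⟩ := B.p_succ B.n B.one_le_n
  have h := B.ofPath_p_succ_n
  rw [ht, ofPath_append_singleton] at h
  have h2 := h.2
  rw [step_eq_of_kind_eq_free h.1] at h2
  dsimp only at h2
  omega

/-- At a point of kind `line` the sign conditions give `b + c ≥ 2`. -/
theorem kind_ofPath_p_n_ne_line : (ofPath (B.p B.n)).kind ≠ .line := by
  intro hk
  obtain ⟨n, hn⟩ := Nat.exists_eq_add_of_le' B.one_le_n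
  have h1 := B.positive_ofPath_p (i := n) (by omega)
  have h2 := B.sum_ofPath_p_n
  rw [hn] at h2 hk
  rw [Positive, hk] at h1
  dsimp only at h1
  omega

/-- A general point of `E_{p_n}` has the same form as the point of the curve. -/
theorem a_ofPath_of_free {t : OnePoint ℂ} (hk : (ofPath (B.p B.n ++ [t])).kind = .free) :
    (ofPath (B.p B.n ++ [t])).a = 0 := by
  have h := B.sum_ofPath_p_n
  rw [ofPath_append_singleton] at hk ⊢
  rw [step_eq_of_kind_eq_free hk]
  dsimp only
  omega

/-- No germ of a member of the pencil other than `d L` leaves `E_{p_n}` along `L`. -/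
theorem kind_ne_line_of_member {a b : ℂ} (ha : a ≠ 0) {t : OnePoint ℂ}
    (hp : PassesThrough (germAtP (C.member a b)) (B.p B.n ++ [t])) :
    (ofPath (B.p B.n ++ [t])).kind ≠ .line := by
  intro hk
  rw [ofPath_append_singleton] at hk
  rcases (ofPath (B.p B.n)).step_trichotomy t with ⟨rfl, h1⟩ | ⟨rfl, h1⟩ | h1
  · rw [step_zero h1] at hk
    rcases AxisKind.strict_eq_line_iff.mp hk with h | h
    · -- here `n = 1` and the curve is not tangent to `L`
      have hnil := eq_nil_of_kind_eq_root h
      rw [hnil] at hp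
      refine C.not_passesThrough_member ha ?_ hp
      obtain ⟨t, ht⟩ := B.p_succ B.n B.one_le_n
      have hpass := B.p_mem (B.n + 1) (by omega)
      have hfree := B.ofPath_p_succ_n.1
      rw [ht] at hpass hfree
      have h2 := (axisOrder_of_kind_eq_free C.unibranch hpass hfree).2.2 h1
      rw [hnil] at h2
      rw [← C.axisOrder_zero_germAtP]
      exact h2.symm
    · exact B.kind_ofPath_p_n_ne_line h
  · rw [step_infty h1] at hk
    cases hk
  · rw [step_of_ne h1.1 h1.2] at hk
    cases hk

end BaseConfiguration

/-! ### Comparison of curvettes -/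

/-- A curvette of a point reached from `q` through general points of successive exceptional
divisors is smooth from `q` on, and equisingular to a curvette of `q` before. -/
theorem IsCurvette.mult_eq_of_free_chain {q r : InfPoint} {t : OnePoint ℂ} {ψ φ : Germ}
    (hψ : IsCurvette (q ++ t :: r) ψ) (hφ : IsCurvette q φ)
    (hk : ∀ r', r' <+: r → (ofPath (q ++ t :: r')).kind = .free) :
    (∀ i ≤ q.length, mult (q.take i) ψ = mult (q.take i) φ) ∧ axisOrder 0 ψ = axisOrder 0 φ ∧
      ∀ r', r' <+: r → mult (q ++ t :: r') ψ = 1 := by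
  obtain ⟨t₁, hp₁, hk₁, ho₁⟩ := hψ.exists_direction
  obtain ⟨t₂, hp₂, hk₂, ho₂⟩ := hφ.exists_direction
  have hassoc : q ++ t :: r ++ [t₁] = (q ++ [t]) ++ (r ++ [t₁]) := by simp
  rw [hassoc] at hp₁ hk₁ ho₁
  have hchain := axisOrder_one_eq_one_of_prefix hψ.1 hp₁ (fun r' hr' => by
    rcases List.prefix_concat_iff.mp hr' with rfl | hr'
    · exact hk₁
    · simpa using hk r' hr') ho₁
  have hpass : ∀ r', r' <+: r ++ [t₁] → PassesThrough ψ ((q ++ [t]) ++ r') := by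
    rintro r' ⟨r'', hr'⟩
    rw [← hr', ← List.append_assoc] at hp₁
    exact hp₁.of_append
  have hp₀ := hpass [] List.nil_prefix
  have ho₀ := hchain [] List.nil_prefix
  rw [List.append_nil] at hp₀ ho₀
  have hk₀ := hk [] List.nil_prefix
  obtain ⟨e1, e2, e3⟩ := axisOrder_of_kind_eq_free hψ.1 hp₀ hk₀
  obtain ⟨g1, g2, g3⟩ := axisOrder_of_kind_eq_free hφ.1 hp₂ hk₂
  rw [← e1, ho₀] at e2 e3
  rw [← g1, ho₂] at g2 g3
  obtain ⟨h1, h2⟩ := mult_eq_of_axisOrder_eq hψ.1 hφ.1 hp₀.of_append hp₂.of_append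
    (fun h => (e2 h).trans (g2 h).symm) (fun h => (e3 h).trans (g3 h).symm)
  refine ⟨fun i hi => ?_, h2, ?_⟩
  · rcases hi.lt_or_eq with hi | rfl
    · exact h1 i hi
    · rw [List.take_length, mult_eq_one hψ.1 hp₀ ho₀, mult_eq_one hφ.1 hp₂ ho₂]
  · rintro r' ⟨r'', hr'⟩
    obtain ⟨t', ht'⟩ : ∃ t', r' ++ [t'] <+: r ++ [t₁] := by
      rcases r'' with _ | ⟨t', r''⟩
      · exact ⟨t₁, by rw [← hr', List.append_nil]⟩
      · exact ⟨t', r'' ++ [t₁], by rw [← hr']; simp⟩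
    have h3 := hpass _ ht'
    have h4 := hchain _ ht'
    rw [← List.append_assoc] at h3 h4
    have := mult_eq_one hψ.1 h3 h4
    simpa using this

theorem IsCurvette.interMult_germL {q : InfPoint} {φ : Germ} (h : IsCurvette q φ) :
    interMult germL φ = (axisOrder 0 φ).toNat := by
  obtain ⟨t, hp, hk, -⟩ := h.exists_direction
  rw [germL_eq, interMult_X_one (axisOrder_zero_ne_top_of_kind_eq_free h.1 hp hk)]

/-! ### An inequality for symmetric bilinear forms -/

/-- The vectors `V + W j` with `W j` orthogonal to each other, to `V` and to `D`, and not too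
negative, can be combined with `D` into a vector of nonnegative square. -/
theorem bilinForm_self_nonneg {E ι : Type*} [AddCommGroup E] [Module ℝ E]
    (B : LinearMap.BilinForm ℝ E) (hB : ∀ x y, B x y = B y x) {J : Finset ι} {ℓ : ι → ℝ}
    (hℓ : ∀ j ∈ J, 0 < ℓ j) {V D : E} {W : ι → E} (hVV : B V V = 0) (hDD : 0 ≤ B D D)
    (hVW : ∀ j ∈ J, B V (W j) = 0) (hDW : ∀ j ∈ J, B D (W j) = 0)
    (hWW : ∀ i ∈ J, ∀ j ∈ J, i ≠ j → B (W i) (W j) = 0)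
    (hW : ∀ j ∈ J, -ℓ j ≤ B (W j) (W j)) :
    0 ≤ B (B D V • ∑ j ∈ J, ((∏ i ∈ J, ℓ i) / ℓ j) • (V + W j) + (∏ i ∈ J, ℓ i) • D)
      (B D V • ∑ j ∈ J, ((∏ i ∈ J, ℓ i) / ℓ j) • (V + W j) + (∏ i ∈ J, ℓ i) • D) := by
  set P := ∏ i ∈ J, ℓ i with hP
  have hP0 : 0 < P := Finset.prod_pos hℓ
  set c : ι → ℝ := fun j => P / ℓ j with hc
  set σ := ∑ j ∈ J, c j with hσ
  set w := ∑ j ∈ J, c j • W j with hw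
  have hσ0 : 0 ≤ σ := Finset.sum_nonneg fun j hj => (div_pos hP0 (hℓ j hj)).le
  have hsum : ∑ j ∈ J, c j • (V + W j) = σ • V + w := by
    simp only [smul_add, Finset.sum_add_distrib, ← Finset.sum_smul, hσ, hw]
  have h1 : B V w = 0 := by
    rw [hw, map_sum]
    exact Finset.sum_eq_zero fun j hj => by rw [map_smul, hVW j hj, smul_zero]
  have h2 : B D w = 0 := by
    rw [hw, map_sum]
    exact Finset.sum_eq_zero fun j hj => by rw [map_smul, hDW j hj, smul_zero]
  have h3 : -(P * σ) ≤ B w w := by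
    have e : B w w = ∑ j ∈ J, c j ^ 2 * B (W j) (W j) := by
      simp only [hw, map_sum, map_smul, LinearMap.sum_apply, LinearMap.smul_apply, smul_eq_mul]
      refine Finset.sum_congr rfl fun j hj => ?_
      rw [Finset.sum_eq_single_of_mem j hj]
      · ring
      · intro i hi hij
        rw [hWW i hi j hj hij, mul_zero]
    rw [e, hσ, Finset.mul_sum, ← Finset.sum_neg_distrib]
    refine Finset.sum_le_sum fun j hj => ?_
    have e2 : P * c j = c j ^ 2 * ℓ j := by
      have := (hℓ j hj).ne'
      simp only [hc]
      field_simp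
    rw [e2]
    nlinarith [mul_le_mul_of_nonneg_left (hW j hj) (sq_nonneg (c j))]
  have e : B (B D V • (σ • V + w) + P • D) (B D V • (σ • V + w) + P • D) =
      B D V ^ 2 * B w w + 2 * (B D V ^ 2 * (P * σ)) + P ^ 2 * B D D := by
    simp only [map_add, map_smul, LinearMap.add_apply, LinearMap.smul_apply, smul_eq_mul,
      hVV, h1, h2, hB w V, hB w D, hB V D]
    ring
  rw [hsum, e]
  have h4 := mul_le_mul_of_nonneg_left h3 (sq_nonneg (B D V))
  have h5 : 0 ≤ B D V ^ 2 * (P * σ) := by positivity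
  have h6 : 0 ≤ P ^ 2 * B D D := by positivity
  linarith

namespace ExtendedConfiguration

variable {C : CurveOnePlace} (S : ExtendedConfiguration C)

/-! ### The points of the extended configuration -/

theorem p_mem_points {i : ℕ} (hi : i < S.n) : S.p (i + 1) ∈ S.points := by
  classical
  rw [points, Finset.mem_union]
  exact Or.inl (Finset.mem_image_of_mem _ (Finset.mem_Icc.mpr ⟨by omega, by omega⟩))

theorem pt_mem_points {j : Fin S.k} {i : ℕ} (h1 : 1 ≤ i) (hi : i ≤ S.s j) :
    S.pt j i ∈ S.points := by
  classical
  rw [points, Finset.mem_union]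
  exact Or.inr (Finset.mem_biUnion.mpr ⟨j, Finset.mem_univ j,
    Finset.mem_image_of_mem _ (Finset.mem_Icc.mpr ⟨h1, hi⟩)⟩)

/-- The free points over a point of `E_{p_n}`: none of them lies on the strict transform of `L`. -/
theorem exists_pt_eq (j : Fin S.k) {i : ℕ} (hi : i < S.s j) :
    ∃ t r, S.pt j 1 = S.p S.n ++ [t] ∧ S.pt j (i + 1) = S.p S.n ++ t :: r ∧ r.length = i ∧
      ∀ r', r' <+: r → (ofPath (S.p S.n ++ t :: r')).kind = .free := by
  induction i with
  | zero =>
    obtain ⟨t, ht⟩ := S.pt_one j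
    refine ⟨t, [], ht, ht, rfl, fun r' hr' => ?_⟩
    rw [List.prefix_nil.mp hr']
    obtain ⟨a, b, ha, hmem⟩ := S.pt_mem j
    have hm := hmem 1 le_rfl (S.s_pos j)
    have hf := S.pt_free j 1 le_rfl (S.s_pos j)
    rw [ht] at hm hf
    exact kind_eq_free (by simp) hf (S.kind_ne_line_of_member ha hm)
  | succ i ih =>
    obtain ⟨t, r, h1, h2, h3, h4⟩ := ih (by omega)
    obtain ⟨t', ht'⟩ := S.pt_succ j (i + 1) (by omega) hi
    have hf := S.pt_free j (i + 1 + 1) (by omega) hi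
    rw [h2] at ht'
    refine ⟨t, r ++ [t'], h1, by rw [ht']; simp, by simp [h3], fun r' hr' => ?_⟩
    rcases List.prefix_concat_iff.mp hr' with rfl | hr'
    · have hr := h4 r (List.prefix_refl r)
      rw [ht'] at hf
      have hline : (ofPath (S.p S.n ++ t :: r ++ [t'])).kind ≠ .line := by
        intro hl
        rw [ofPath_append_singleton] at hl
        rcases (ofPath (S.p S.n ++ t :: r)).step_trichotomy t' with ⟨rfl, h⟩ | ⟨rfl, h⟩ | h
        · exact h hr
        · rw [step_infty h] at hl
          cases hl
        · rw [step_of_ne h.1 h.2] at hl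
          cases hl
      have := kind_eq_free (by simp) hf hline
      simpa using this
    · exact h4 r' hr'

/-! ### The intersection form -/

theorem inter_comm (x y : S.NS) : S.inter x y = S.inter y x := by
  simp only [inter, mul_comm]

/-- The intersection product as a bilinear form. -/
noncomputable def interForm : LinearMap.BilinForm ℝ S.NS :=
  LinearMap.mk₂ ℝ S.inter
    (fun x y z => by
      simp only [inter, Pi.add_apply, add_mul, Finset.sum_add_distrib]
      ring)
    (fun r x y => by
      simp only [inter, Pi.smul_apply, smul_eq_mul, mul_assoc, ← Finset.mul_sum]
      ring)
    (fun x y z => by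
      simp only [inter, Pi.add_apply, mul_add, Finset.sum_add_distrib]
      ring)
    (fun r x y => by
      simp only [inter, Pi.smul_apply, smul_eq_mul, mul_left_comm _ r, ← Finset.mul_sum]
      ring)

variable (φ : InfPoint → Germ)

theorem divisor_none (q : InfPoint) : S.divisor φ q none = interMult germL (φ q) := by
  simp [divisor, lineClass, excClass, Finset.sum_apply]

open Classical in
theorem divisor_some (q : InfPoint) (q' : {q : InfPoint // q ∈ S.points}) :
    S.divisor φ q (some q') = if q'.1 <+: q then -(mult q'.1 (φ q) : ℝ) else 0 := by
  have h : S.divisor φ q (some q') = -if q'.1 <+: q then (mult q'.1 (φ q) : ℝ) else 0 := by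
    simp [divisor, lineClass, excClass, Finset.sum_apply, Pi.single_apply]
  rw [h]
  split_ifs <;> simp

open Classical in
theorem sum_prefix {Q : InfPoint} (hQ : ∀ i ≤ Q.length, Q.take i ∈ S.points)
    (f : InfPoint → ℝ) : (∑ q : {q : InfPoint // q ∈ S.points}, if q.1 <+: Q then f q.1 else 0) =
      ∑ i ∈ Finset.range (Q.length + 1), f (Q.take i) := by
  rw [← Finset.sum_filter]
  symm
  refine Finset.sum_bij (fun i hi => ⟨Q.take i, hQ i (by
    rw [Finset.mem_range] at hi; omega)⟩) ?_ ?_ ?_ ?_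
  · intro i hi
    simp [List.take_prefix]
  · intro i hi i' hi' h
    rw [Finset.mem_range] at hi hi'
    have := congrArg List.length (Subtype.ext_iff.mp h)
    simp only [List.length_take] at this
    omega
  · rintro ⟨q, hq⟩ h
    have hpre : q <+: Q := by simpa using h
    exact ⟨q.length, Finset.mem_range.mpr (Nat.lt_succ_of_le hpre.length_le),
      Subtype.ext (List.prefix_iff_eq_take.mp hpre).symm⟩
  · intro i hi
    rfl

/-- The self-intersection of `D_q` is the constant coefficient of the form of a general point
of `E_q`. -/
theorem exists_inter_divisor_eq {Q : InfPoint} (hQ : ∀ i ≤ Q.length, Q.take i ∈ S.points)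
    (hφ : IsCurvette Q (φ Q)) : ∃ t, (ofPath (Q ++ [t])).kind = .free ∧
      S.inter (S.divisor φ Q) (S.divisor φ Q) = (ofPath (Q ++ [t])).a := by
  classical
  obtain ⟨t, hp, hk, ho⟩ := hφ.exists_direction
  refine ⟨t, hk, ?_⟩
  rw [← hφ.sq_sub_sum hp hk ho, inter, divisor_none, hφ.interMult_germL]
  push_cast
  rw [← S.sum_prefix hQ fun q => (mult q (φ Q) : ℝ) ^ 2, ← sq]
  congr 1
  refine Finset.sum_congr rfl fun q _ => ?_
  rw [divisor_some]
  split_ifs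
  · ring
  · ring

variable {φ}

theorem exists_inter_D₀_eq (hφ : ∀ q ∈ S.points, IsCurvette q (φ q))
    {m : ℕ} (hm : m < S.n) : ∃ t, (ofPath (S.p (m + 1) ++ [t])).kind = .free ∧
    S.inter (S.D₀ φ (m + 1)) (S.D₀ φ (m + 1)) = (ofPath (S.p (m + 1) ++ [t])).a := by
  refine S.exists_inter_divisor_eq φ (fun i hi => ?_) (hφ _ (S.p_mem_points hm))
  rw [S.length_p] at hi
  rw [S.take_p hi]
  exact S.p_mem_points (by omega)

theorem inter_D₀_self_nonneg (hφ : ∀ q ∈ S.points, IsCurvette q (φ q))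
    {m : ℕ} (hm : m ≤ S.n) :
    0 ≤ S.inter (S.D₀ φ m) (S.D₀ φ m) := by
  rcases m with _ | m
  · simp [D₀, inter, lineClass]
  · obtain ⟨t, hk, h⟩ := S.exists_inter_D₀_eq hφ hm
    rw [h]
    rw [ofPath_append_singleton] at hk ⊢
    rcases (S.positive_ofPath_p hm).step t with h | h
    · rw [Positive, hk] at h
      exact_mod_cast zero_le_one.trans h.1
    · exact_mod_cast h.2

theorem inter_D₀_n_self (hφ : ∀ q ∈ S.points, IsCurvette q (φ q))
    : S.inter (S.D₀ φ S.n) (S.D₀ φ S.n) = 0 := by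
  obtain ⟨n, hn⟩ := Nat.exists_eq_add_of_le' S.one_le_n
  obtain ⟨t, hk, h⟩ := S.exists_inter_D₀_eq hφ (m := n) (by omega)
  rw [← hn] at h hk
  rw [h, S.a_ofPath_of_free hk, Int.cast_zero]

/-- The classes `D_{0 m}` do not involve the exceptional divisors of the points after `p_n`. -/
theorem D₀_some_eq_zero {m : ℕ} (hm : m ≤ S.n) {q : {q : InfPoint // q ∈ S.points}}
    (hq : S.n ≤ q.1.length) : S.D₀ φ m (some q) = 0 := by
  rcases m with _ | m
  · simp [D₀, lineClass]
  · rw [D₀, divisor_some, if_neg]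
    intro h
    have := h.length_le
    rw [S.length_p] at this
    omega

theorem D₀_n : S.D₀ φ S.n = S.divisor φ (S.p S.n) := by
  obtain ⟨n, hn⟩ := Nat.exists_eq_add_of_le' S.one_le_n
  rw [hn, D₀]

theorem D_sub_D₀_none (hφ : ∀ q ∈ S.points, IsCurvette q (φ q))
    {j : Fin S.k} {ℓ : ℕ} (h1 : 1 ≤ ℓ) (hℓ : ℓ ≤ S.s j) :
    (S.D φ j ℓ - S.D₀ φ S.n) none = 0 := by
  obtain ⟨ℓ, rfl⟩ := Nat.exists_eq_add_of_le' h1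
  obtain ⟨n, hn⟩ := Nat.exists_eq_add_of_le' S.one_le_n
  obtain ⟨t, r, -, h2, -, h4⟩ := S.exists_pt_eq j hℓ
  have hψ := hφ _ (S.pt_mem_points h1 hℓ)
  have hV := hφ _ (S.p_mem_points (i := n) (by omega))
  rw [← hn] at hV
  have h := hψ
  rw [h2] at h
  obtain ⟨-, h5, -⟩ := h.mult_eq_of_free_chain hV h4
  rw [Pi.sub_apply, D, D₀_n, divisor_none, divisor_none, hψ.interMult_germL, hV.interMult_germL,
    h2, h5, sub_self]

open Classical in
/-- The class `D_{j ℓ} - D_{0 n}` is minus the sum of the classes `E_{j i}^*` with `1 ≤ i ≤ ℓ`: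
the points `p_{j i}` are those before `p_{j ℓ}` whose list of directions has length at least `n`.
-/
theorem D_sub_D₀_some (hφ : ∀ q ∈ S.points, IsCurvette q (φ q))
    {j : Fin S.k} {ℓ : ℕ} (h1 : 1 ≤ ℓ) (hℓ : ℓ ≤ S.s j)
    (q : {q : InfPoint // q ∈ S.points}) : (S.D φ j ℓ - S.D₀ φ S.n) (some q) =
      if q.1 <+: S.pt j ℓ ∧ S.n ≤ q.1.length then -1 else 0 := by
  obtain ⟨ℓ, rfl⟩ := Nat.exists_eq_add_of_le' h1
  obtain ⟨n, hn⟩ := Nat.exists_eq_add_of_le' S.one_le_n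
  obtain ⟨t, r, -, h2, -, h4⟩ := S.exists_pt_eq j hℓ
  have hψ := hφ _ (S.pt_mem_points h1 hℓ)
  have hV := hφ _ (S.p_mem_points (i := n) (by omega))
  have hlen := S.length_p n
  rw [← hn] at hV hlen
  rw [h2] at hψ
  obtain ⟨h5, -, h6⟩ := hψ.mult_eq_of_free_chain hV h4
  by_cases hq : S.n ≤ q.1.length
  · rw [Pi.sub_apply, S.D₀_some_eq_zero le_rfl hq, sub_zero, D, divisor_some, h2]
    by_cases hp : q.1 <+: S.p S.n ++ t :: r
    · rw [if_pos hp, if_pos ⟨hp, hq⟩]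
      have hpre : S.p S.n ++ [t] <+: q.1 :=
        List.prefix_of_prefix_length_le ⟨r, by simp⟩ hp (by simp; omega)
      obtain ⟨r', hr'⟩ := hpre
      have hr'' : r' <+: r := by
        rw [← hr'] at hp
        simpa using hp
      have := h6 r' hr''
      rw [← hr', List.append_assoc, List.singleton_append, this, Nat.cast_one]
    · rw [if_neg hp, if_neg fun h => hp h.1]
  · rw [if_neg fun h => hq h.2, Pi.sub_apply, D₀_n, D, divisor_some, divisor_some, h2]
    have hiff : q.1 <+: S.p S.n ++ t :: r ↔ q.1 <+: S.p S.n :=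
      ⟨fun h => List.prefix_of_prefix_length_le h (List.prefix_append _ _) (by omega),
        fun h => h.trans (List.prefix_append _ _)⟩
    by_cases hp : q.1 <+: S.p S.n
    · rw [if_pos hp, if_pos (hiff.mpr hp)]
      have := h5 q.1.length hp.length_le
      rw [← List.prefix_iff_eq_take.mp hp] at this
      rw [this, sub_self]
    · rw [if_neg hp, if_neg fun h => hp (hiff.mp h), sub_self]

theorem inter_D₀_D_sub_D₀ (hφ : ∀ q ∈ S.points, IsCurvette q (φ q))
    {m : ℕ} (hm : m ≤ S.n) {j : Fin S.k} {ℓ : ℕ} (h1 : 1 ≤ ℓ)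
    (hℓ : ℓ ≤ S.s j) : S.inter (S.D₀ φ m) (S.D φ j ℓ - S.D₀ φ S.n) = 0 := by
  rw [inter, S.D_sub_D₀_none hφ h1 hℓ, mul_zero, zero_sub, neg_eq_zero]
  refine Finset.sum_eq_zero fun q _ => ?_
  rw [S.D_sub_D₀_some hφ h1 hℓ]
  split_ifs with h
  · rw [S.D₀_some_eq_zero hm h.2, zero_mul]
  · rw [mul_zero]

theorem inter_D_sub_D₀_of_ne (hφ : ∀ q ∈ S.points, IsCurvette q (φ q))
    {i j : Fin S.k} (hij : i ≠ j) {ℓ ℓ' : ℕ} (h1 : 1 ≤ ℓ)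
    (hℓ : ℓ ≤ S.s i) (h1' : 1 ≤ ℓ') (hℓ' : ℓ' ≤ S.s j) :
    S.inter (S.D φ i ℓ - S.D₀ φ S.n) (S.D φ j ℓ' - S.D₀ φ S.n) = 0 := by
  rw [inter, S.D_sub_D₀_none hφ h1 hℓ, zero_mul, zero_sub, neg_eq_zero]
  refine Finset.sum_eq_zero fun q _ => ?_
  rw [S.D_sub_D₀_some hφ h1 hℓ, S.D_sub_D₀_some hφ h1' hℓ']
  by_cases h : q.1 <+: S.pt i ℓ ∧ S.n ≤ q.1.length
  · by_cases h' : q.1 <+: S.pt j ℓ' ∧ S.n ≤ q.1.length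
    · exfalso
      obtain ⟨n, hn⟩ := Nat.exists_eq_add_of_le' S.one_le_n
      have hlen := S.length_p n
      rw [← hn] at hlen
      obtain ⟨ℓ, rfl⟩ := Nat.exists_eq_add_of_le' h1
      obtain ⟨ℓ', rfl⟩ := Nat.exists_eq_add_of_le' h1'
      obtain ⟨t, r, h2, h3, -⟩ := S.exists_pt_eq i hℓ
      obtain ⟨t', r', h2', h3', -⟩ := S.exists_pt_eq j hℓ'
      have e : S.pt i 1 <+: q.1 :=
        List.prefix_of_prefix_length_le ⟨r, by rw [h2, h3]; simp⟩ h.1 (by rw [h2]; simp; omega)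
      have e' : S.pt j 1 <+: q.1 :=
        List.prefix_of_prefix_length_le ⟨r', by rw [h2', h3']; simp⟩ h'.1
          (by rw [h2']; simp; omega)
      have := (List.prefix_of_prefix_length_le e e' (by rw [h2, h2']; simp)).eq_of_length
        (by rw [h2, h2']; simp)
      exact hij (S.pt_one_injective this)
    · rw [if_neg h', mul_zero]
  · rw [if_neg h, zero_mul]

/-- At most `ℓ` points before `p_{j ℓ}`, or equal to it, have a list of directions of length at
least `n`. -/
theorem neg_le_inter_D_sub_D₀ (hφ : ∀ q ∈ S.points, IsCurvette q (φ q))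
    {j : Fin S.k} {ℓ : ℕ} (h1 : 1 ≤ ℓ) (hℓ : ℓ ≤ S.s j) :
    -(ℓ : ℝ) ≤ S.inter (S.D φ j ℓ - S.D₀ φ S.n) (S.D φ j ℓ - S.D₀ φ S.n) := by
  classical
  rw [inter, S.D_sub_D₀_none hφ h1 hℓ, zero_mul, zero_sub, neg_le_neg_iff]
  have e : ∀ q : {q : InfPoint // q ∈ S.points},
      (S.D φ j ℓ - S.D₀ φ S.n) (some q) * (S.D φ j ℓ - S.D₀ φ S.n) (some q) =
        if q.1 <+: S.pt j ℓ ∧ S.n ≤ q.1.length then 1 else 0 := fun q => by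
    rw [S.D_sub_D₀_some hφ h1 hℓ]
    split_ifs <;> simp
  rw [Finset.sum_congr rfl fun q _ => e q, Finset.sum_boole, Nat.cast_le]
  obtain ⟨n, hn⟩ := Nat.exists_eq_add_of_le' S.one_le_n
  have hlen := S.length_p n
  rw [← hn] at hlen
  obtain ⟨ℓ, rfl⟩ := Nat.exists_eq_add_of_le' h1
  obtain ⟨t, r, -, h3, h4, -⟩ := S.exists_pt_eq j hℓ
  have hcard : (Finset.Ico S.n (S.n + (ℓ + 1))).card = ℓ + 1 := by simp
  rw [← hcard]
  refine Finset.card_le_card_of_injOn (fun q => q.1.length) ?_ ?_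
  · intro q hq
    have hq : q.1 <+: S.pt j (ℓ + 1) ∧ S.n ≤ q.1.length := by simpa using hq
    have := hq.1.length_le
    rw [h3, List.length_append, List.length_cons, h4, hlen] at this
    simp only [Finset.coe_Ico, Set.mem_Ico]
    omega
  · intro q hq q' hq' h
    have hq : q.1 <+: S.pt j (ℓ + 1) ∧ S.n ≤ q.1.length := by simpa using hq
    have hq' : q'.1 <+: S.pt j (ℓ + 1) ∧ S.n ≤ q'.1.length := by simpa using hq'
    exact Subtype.ext
      ((List.prefix_of_prefix_length_le hq.1 hq'.1 (le_of_eq h)).eq_of_length h)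

theorem inter_DJ_self_nonneg (hφ : ∀ q ∈ S.points, IsCurvette q (φ q))
    {J : Finset (Fin S.k)} {ℓ : Fin S.k → ℕ}
    (hℓ : ∀ j ∈ J, 1 ≤ ℓ j ∧ ℓ j ≤ S.s j) {m : ℕ} (hm : m ≤ S.n) :
    0 ≤ S.inter (S.DJ φ J ℓ m) (S.DJ φ J ℓ m) := by
  have := bilinForm_self_nonneg S.interForm S.inter_comm (J := J) (ℓ := fun j => (ℓ j : ℝ))
    (V := S.D₀ φ S.n) (D := S.D₀ φ m) (W := fun j => S.D φ j (ℓ j) - S.D₀ φ S.n)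
    (fun j hj => Nat.cast_pos.mpr (hℓ j hj).1) (S.inter_D₀_n_self hφ)
    (S.inter_D₀_self_nonneg hφ hm)
    (fun j hj => S.inter_D₀_D_sub_D₀ hφ le_rfl (hℓ j hj).1 (hℓ j hj).2)
    (fun j hj => S.inter_D₀_D_sub_D₀ hφ hm (hℓ j hj).1 (hℓ j hj).2)
    (fun i hi j hj hij => S.inter_D_sub_D₀_of_ne hφ hij (hℓ i hi).1 (hℓ i hi).2 (hℓ j hj).1
      (hℓ j hj).2)
    (fun j hj => S.neg_le_inter_D_sub_D₀ hφ (hℓ j hj).1 (hℓ j hj).2)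
  simp only [add_sub_cancel] at this
  exact this

end ExtendedConfiguration

end PencilAtInfinity


theorem proposition3p3
    (C : PencilAtInfinity.CurveOnePlace)
    (S : PencilAtInfinity.ExtendedConfiguration C)
    (φ : PencilAtInfinity.InfPoint → PencilAtInfinity.Germ)
    (hφ : ∀ q ∈ S.points, PencilAtInfinity.IsCurvette q (φ q)) :
    (∀ m : ℕ, m ≤ S.n → 0 ≤ S.inter (S.D₀ φ m) (S.D₀ φ m)) ∧
    (∀ J : Finset (Fin S.k), J.Nonempty →
      ∀ ℓ : Fin S.k → ℕ, (∀ j ∈ J, 1 ≤ ℓ j ∧ ℓ j ≤ S.s j) →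
        ∀ m : ℕ, m < S.n →
          0 ≤ S.inter (S.DJ φ J ℓ m) (S.DJ φ J ℓ m)) :=
  ⟨fun _ hm => S.inter_D₀_self_nonneg hφ hm,
    fun _ _ _ hℓ _ hm => S.inter_DJ_self_nonneg hφ hℓ hm.le⟩
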